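/- Let $r>0$, let $\nu$ be a finite measure on $[0,1]$ that is continuous (i.e. $\nu\{b\}=0$ for every $b$), let $\psi_1,\dots,\psi_L\in[0,1]$ ($L\ge 0$ finite) be distinct, and let $h_1,\dots,h_L$ be probability measures on $[0,1]$ with $h_l\{1\}=0$. Let $B$ be the completely random measure on $[0,1]$ $$B=\sum_{l=1}^{L}\xi_l\,\delta_{\psi_l}+\sum_{j}b_j\,\delta_{\theta_j},$$ where $\xi_l\sim h_l$ are independent, and independent of the points $(b_j,\theta_j)$ of a Poisson point process on $[0,1]\times[0,1]$ with intensity $\nu(db)\,d\theta$ (there is no deterministic component). Given $B$, let $I$ be a negative binomial process with shape $r$ and base measure $B$: if $B=\sum_k b_k\delta_{\phi_k}$ with distinct $\phi_k$ and $b_k>0$, then $I=\sum_k i_k\delta_{\phi_k}$ with independent $i_k\sim \mathrm{NegBin}(r,b_k)$, where $\mathrm{NegBin}(r,b)$ has mass $\frac{\Gamma(k+r)}{k!\,\Gamma(r)}(1-b)^r b^k$ at $k=0,1,2,\dots$. Then $I$ has almost surely finitely many atoms and integer weights; let $s_1,\dots,s_K$ be its distinct atom locations and $n_1,\dots,n_K\ge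 1$ the corresponding counts. There is a regular conditional distribution of $B$ given $I$ which, for almost every value of $I$, is the law of a completely random measure (its masses on pairwise disjoint measurable sets are independent) with no deterministic component and with the following mutually independent components. 1. An ordinary component $\sum_j b_j\delta_{\theta_j}$, with $(b_j,\theta_j)$ the points of a Poisson point process with intensity $(1-b)^r\,\nu(db)\,d\theta$. 2. For each $l$ with $\psi_l=s_k$ for some $k$, a fixed atom at $\psi_l$ with weight law $c^{-1}(1-b)^r b^{n_k}\,h_l(db)$, where $c=\int_0^1(1-b)^r b^{n_k}\,h_l(db)$. 3. For each $l$ with $\psi_l\notin\{s_1,\dots,s_K\}$, a fixed atom at $\psi_l$ with weight law $c^{-1}(1-b)^r\,h_l(db)$, where $c=\int_0^1(1-b)^r\,h_l(db)$. 4. For each $k$ with $s_k\notin\{\psi_1,\dots,\psi_L\}$, a fixed atom at $s_k$ with weight law $c^{-1}(1-b)^r b^{n_k}\,\nu(db)$, where $c=\int_0^1(1-b)^r b^{n_k}\,\nu(db)$. -/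

import Mathlib

open MeasureTheory ProbabilityTheory

open scoped ENNReal unitInterval

noncomputable section

/- Random measures on `X` are random elements of `Measure X`, which carries the σ-algebra generated
by the evaluations `μ ↦ μ A`, `A` measurable.  Weights and locations of atoms lie in
`I = unitInterval`, whose `volume` is Lebesgue measure. -/

/-- Law `Q` of a completely random measure: the masses of pairwise disjoint measurable sets are
independent. -/
def IsCompletelyRandom {X : Type*} [MeasurableSpace X] (Q : Measure (Measure X)) : Prop :=
  ∀ A : ℕ → Set X, (∀ n, MeasurableSet (A n)) → Pairwise (fun i j => Disjoint (A i) (A j)) →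
    iIndepFun (fun n (μ : Measure X) => μ (A n)) Q

/-- Law, as a random counting measure, of the Poisson point process with finite intensity `m`: the
number `J` of points is Poisson with mean `λ = m univ` and, given `J = j`, the points are
i.i.d. with law `m / λ`, so that the factor `e^{-λ} λ^j / j!` times the law of the points is
`e^{-λ} / j!` times the product measure `m^j`. -/
def poissonProcessLaw {Y : Type*} [MeasurableSpace Y] (m : Measure Y) : Measure (Measure Y) :=
  Measure.sum fun j : ℕ =>
    ENNReal.ofReal (Real.exp (-(m Set.univ).toReal) / (j.factorial : ℝ)) •
      (Measure.pi fun _ : Fin j => m).map fun y => ∑ i, Measure.dirac (y i)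

/-- The measure `∑ b_j δ_{ψ_j}` built from the configuration `N = ∑ δ_{(b_j, ψ_j)}` of
weight-location pairs. -/
def weightedSum {X : Type*} [MeasurableSpace X] (N : Measure (I × X)) : Measure X :=
  (N.withDensity fun p => ENNReal.ofReal (p.1 : ℝ)).map Prod.snd

/-- Law of the completely random measure on `X` with no deterministic component, with ordinary
component driven by a Poisson point process of finite intensity `m` on weights × locations, and
with finitely many fixed atoms, at `loc k` with weight of law `h k`; the fixed weights and the
Poisson process are independent. -/
def crmLaw {X : Type*} [MeasurableSpace X] {κ : Type*} [Fintype κ] (m : Measure (I × X))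
    (loc : κ → X) (h : κ → Measure I) : Measure (Measure X) :=
  ((Measure.pi h).prod (poissonProcessLaw m)).map fun q =>
    (∑ k, ENNReal.ofReal (q.1 k : ℝ) • Measure.dirac (loc k)) + weightedSum q.2

/-- The negative binomial distribution `NegBin(r, b)` on `ℕ`, with mass
`Γ(k + r) / (k! Γ(r)) (1 - b)^r b^k` at `k`; a probability measure for `r > 0` and `0 ≤ b < 1`. -/
def negBin (r b : ℝ) : Measure ℕ :=
  Measure.sum fun k : ℕ =>
    ENNReal.ofReal (Real.Gamma (k + r) / (k.factorial * Real.Gamma r) * (1 - b) ^ r * b ^ k) •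
      Measure.dirac k

/-- `Q` is the law of a negative binomial process with shape `r` and discrete base measure
`μ = ∑ b_x δ_x` (sum over the atoms of `μ`): the random measure is a.s. of the form `∑ i_x δ_x`, with
independent `i_x ∼ NegBin(r, b_x)`. -/
structure IsNegBinProcess {X : Type*} [MeasurableSpace X] (r : ℝ) (μ : Measure X)
    (Q : Measure (Measure X)) : Prop where
  eq_sum : ∀ᵐ ι ∂Q,
    ι = Measure.sum fun x : {x : X // μ {x} ≠ 0} => ι {(x : X)} • Measure.dirac (x : X)
  law : ∀ x : X, μ {x} ≠ 0 →
    Q.map (fun ι => ι {x}) = (negBin r (μ {x}).toReal).map (fun k : ℕ => (k : ℝ≥0∞))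
  indep : iIndepFun (fun (x : {x : X // μ {x} ≠ 0}) (ι : Measure X) => ι {(x : X)}) Q

/-- Some regular conditional distribution of `Y` given `U` has, at almost every value `u` of `U`,
a value satisfying `q u`. -/
def CondLawSatisfies {Ω α β : Type*} [MeasurableSpace Ω] [MeasurableSpace α] [MeasurableSpace β]
    (P : Measure Ω) (U : Ω → α) (Y : Ω → β) (q : α → Measure β → Prop) : Prop :=
  ∃ κ : Kernel α β, IsMarkovKernel κ ∧
    P.map (fun ω => (U ω, Y ω)) = (P.map U) ⊗ₘ κ ∧ ∀ᵐ u ∂(P.map U), q u (κ u)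

/-- The measure `(1 - b)^r b^k ρ(db)`. -/
def reweight (r : ℝ) (k : ℕ) (ρ : Measure I) : Measure I :=
  ρ.withDensity fun b => ENNReal.ofReal ((1 - (b : ℝ)) ^ r * (b : ℝ) ^ k)

/-- The probability measure `c⁻¹ (1 - b)^r b^k ρ(db)`, where `c` is the total mass of
`(1 - b)^r b^k ρ(db)`. -/
def tilt (r : ℝ) (k : ℕ) (ρ : Measure I) : Measure I :=
  (reweight r k ρ Set.univ)⁻¹ • reweight r k ρ

/-- The counting measure `∑ n_x δ_x`, with `n_x = 0` for all but finitely many `x`. -/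
def countingMeasure {X : Type*} [MeasurableSpace X] (n : X →₀ ℕ) : Measure X :=
  ∑ x ∈ n.support, (n x : ℝ≥0∞) • Measure.dirac x

open Classical in
/-- The observed locations (those with `n_x ≠ 0`) that are not among the old fixed atoms. -/
def newLocations {X : Type*} {L : ℕ} (ψ : Fin L → X) (n : X →₀ ℕ) : Finset X :=
  n.support.filter fun x => x ∉ Set.range ψ

/-- The claimed posterior law given the observed counts `n`.  An old fixed atom `ψ l` that was
not observed has `n (ψ l) = 0`, so its new weight law is proportional to `(1 - b)^r h_l(db)`. -/
def posteriorLaw {L : ℕ} (r : ℝ) (ν : Measure I) (ψ : Fin L → I) (h : Fin L → Measure I)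
    (n : I →₀ ℕ) : Measure (Measure I) :=
  crmLaw (κ := Fin L ⊕ {x // x ∈ newLocations ψ n})
    ((reweight r 0 ν).prod volume)
    (Sum.elim ψ fun x => (x : I))
    (Sum.elim (fun l => tilt r (n (ψ l)) (h l)) fun x => tilt r (n (x : I)) ν)

end

/-!
Addition of independent random measures corresponds to convolution of their laws. Under addition
and convolution the s-finite measures on a commutative monoid form a commutative algebra over
`ℝ≥0∞` (`ConvMeasure`), in which a Poisson process is an exponential and
`exp (a + b) = exp a * exp b` is the superposition theorem. The law of `B` is, up to a constant, a
product with one factor for each fixed atom and an exponential for the Poisson process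
(`crmLaw_eq`). Splitting this product along a partition of the space gives complete randomness
(`isCompletelyRandom_crmLaw`).

The hypothesis on `J` given `B` determines the conditional law of `J` when `B` is a finite sum of
atoms at distinct locations (`IsNegBinProcess.eq_map`). Hence the joint law of `(J, B)` is a
product of the same shape, in which the law of the contribution `b δ_x` of an atom is replaced by
the law of the pair `(n δ_x, b δ_x)` with `n` negative binomial given `b`
(`map_swap_crmLaw_compProd`). By `ConvMeasure.exp_add` the exponential splits into the points with
`n = 0`, which form a Poisson process with intensity `(1 - b)^r ν(db) dθ`, and the points with
`n ≠ 0`. Expanding the exponential over the latter and applying Bayes' rule to each atom, where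
`NegBin(r, b)(n) ρ(db)` is a multiple of the tilted law, exhibits the joint law as a mixture over
the labels `y`, the counts and locations of the fixed and of the observed atoms: given the labels,
`J` is the deterministic measure `∑ n_i δ_{x_i}` and `B` is a completely random measure with
tilted weights (`lintegral_jointLaw`, `jointLaw_eq_map_labelsLaw_compProd`).

The labels are not a function of `J`, since the new locations are enumerated in an arbitrary
order, but the conditional law of `B` given the labels almost surely depends only on
`∑ n_i δ_{x_i}`, and is the posterior law (`AdmissibleLabels.crmLaw_eq_posteriorLaw`). It is
therefore also the conditional law given `J` (`exists_kernel_of_compProd_map`); no regular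
conditional distribution on the space of measures is needed, as the labels lie in a standard Borel
space.
-/

/-! ### The semiring of measures under convolution -/

instance {M N : Type*} [MeasurableSpace M] [MeasurableSpace N] [Add M] [Add N] [MeasurableAdd₂ M]
    [MeasurableAdd₂ N] : MeasurableAdd₂ (M × N) :=
  ⟨((measurable_fst.comp measurable_fst).add (measurable_fst.comp measurable_snd)).prodMk
    ((measurable_snd.comp measurable_fst).add (measurable_snd.comp measurable_snd))⟩

/-- The s-finite measures on a space with an addition. With sum and convolution they form a
commutative `ℝ≥0∞`-algebra; s-finiteness is what makes convolution associative and commutative, and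
is preserved by all the operations, including countable sums. -/
def ConvMeasure (M : Type*) [MeasurableSpace M] : Type _ := {μ : Measure M // SFinite μ}

namespace ConvMeasure

variable {M : Type*} [MeasurableSpace M]

/-- The underlying measure. -/
def val (a : ConvMeasure M) : Measure M := Subtype.val a

instance (a : ConvMeasure M) : SFinite a.val := Subtype.property a

/-- An s-finite measure, as an element of the convolution semiring. -/
def of (μ : Measure M) [h : SFinite μ] : ConvMeasure M := ⟨μ, h⟩

@[simp] lemma val_of (μ : Measure M) [SFinite μ] : (of μ).val = μ := rfl

@[ext] lemma ext {a b : ConvMeasure M} (h : a.val = b.val) : a = b := Subtype.ext h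

noncomputable instance : Add (ConvMeasure M) := ⟨fun a b => of (a.val + b.val)⟩
noncomputable instance : Zero (ConvMeasure M) := ⟨of 0⟩
noncomputable instance : SMul ℝ≥0∞ (ConvMeasure M) := ⟨fun c a => of (c • a.val)⟩

@[simp] lemma val_add (a b : ConvMeasure M) : (a + b).val = a.val + b.val := rfl
@[simp] lemma val_zero : (0 : ConvMeasure M).val = 0 := rfl
@[simp] lemma val_smul (c : ℝ≥0∞) (a : ConvMeasure M) : (c • a).val = c • a.val := rfl

variable [AddCommMonoid M]

noncomputable instance : Mul (ConvMeasure M) := ⟨fun a b => of (a.val ∗ b.val)⟩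
noncomputable instance : One (ConvMeasure M) := ⟨of (Measure.dirac 0)⟩

@[simp] lemma val_mul (a b : ConvMeasure M) : (a * b).val = a.val ∗ b.val := rfl
@[simp] lemma val_one : (1 : ConvMeasure M).val = Measure.dirac 0 := rfl

variable [MeasurableAdd₂ M]

noncomputable instance : CommSemiring (ConvMeasure M) where
  add_assoc a b c := ext (add_assoc a.val b.val c.val)
  zero_add a := ext (zero_add a.val)
  add_zero a := ext (add_zero a.val)
  add_comm a b := ext (add_comm a.val b.val)
  mul_assoc a b c := ext (Measure.conv_assoc a.val b.val c.val)
  one_mul a := ext (Measure.dirac_zero_conv a.val)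
  mul_one a := ext (Measure.conv_dirac_zero a.val)
  mul_comm a b := ext (Measure.conv_comm a.val b.val)
  zero_mul a := ext (Measure.zero_conv a.val)
  mul_zero a := ext (Measure.conv_zero a.val)
  left_distrib a b c := ext (Measure.conv_add a.val b.val c.val)
  right_distrib a b c := ext (Measure.add_conv a.val b.val c.val)
  nsmul := nsmulRec

noncomputable instance : Module ℝ≥0∞ (ConvMeasure M) where
  one_smul a := ext (one_smul _ a.val)
  mul_smul c d a := ext (mul_smul c d a.val)
  smul_zero c := ext (smul_zero c)
  smul_add c a b := ext (smul_add c a.val b.val)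
  add_smul c d a := ext (add_smul c d a.val)
  zero_smul a := ext (zero_smul _ a.val)

noncomputable instance : Algebra ℝ≥0∞ (ConvMeasure M) :=
  Algebra.ofModule (fun c a b => ext (Measure.conv_smul_left a.val b.val c))
    (fun c a b => ext (Measure.conv_smul_right a.val b.val c))

lemma lintegral_mul (a b : ConvMeasure M) {f : M → ℝ≥0∞} (hf : Measurable f) :
    ∫⁻ z, f z ∂(a * b).val = ∫⁻ x, ∫⁻ y, f (x + y) ∂b.val ∂a.val :=
  Measure.lintegral_conv hf

/-- The exponential `∑ aʲ / j!` for the convolution product. -/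
noncomputable def exp (a : ConvMeasure M) : ConvMeasure M :=
  of (Measure.sum fun j : ℕ => ((j.factorial : ℝ≥0∞)⁻¹ • a ^ j).val)

lemma val_exp (a : ConvMeasure M) :
    (exp a).val = Measure.sum fun j : ℕ => (j.factorial : ℝ≥0∞)⁻¹ • (a ^ j).val := rfl

lemma sum_conv_sum {ι κ : Type*} [Countable ι] [Countable κ] (a : ι → ConvMeasure M)
    (b : κ → ConvMeasure M) :
    (Measure.sum fun i => (a i).val) ∗ (Measure.sum fun i => (b i).val) =
      Measure.sum fun p : ι × κ => (a p.1 * b p.2).val := by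
  simp only [Measure.conv, val_mul]
  rw [Measure.prod_sum, Measure.map_sum (by fun_prop)]

lemma mul_val_sum {ι : Type*} [Countable ι] (a : ConvMeasure M) (b : ι → ConvMeasure M) :
    (a * of (Measure.sum fun i => (b i).val)).val = Measure.sum fun i => (a * b i).val := by
  simp only [Measure.conv, val_mul, val_of]
  rw [Measure.prod_sum_right, Measure.map_sum (by fun_prop)]

lemma val_finset_sum {ι : Type*} (s : Finset ι) (a : ι → ConvMeasure M) :
    (∑ i ∈ s, a i).val = ∑ i ∈ s, (a i).val := by
  classical
  induction s using Finset.induction with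
  | empty => simp
  | insert i s hi ih => simp [Finset.sum_insert hi, ih]

/-- The exponential turns sums into convolution products: two independent Poisson processes
superpose to a Poisson process. -/
lemma exp_add (a b : ConvMeasure M) : exp (a + b) = exp a * exp b := by
  ext1
  have h1 : (exp a * exp b).val = _ := sum_conv_sum _ _
  rw [h1, val_exp]
  ext s hs
  rw [Measure.sum_apply _ hs, Measure.sum_apply _ hs,
    ← Equiv.tsum_eq (Finset.HasAntidiagonal.sigmaAntidiagonalEquivProd (A := ℕ)),
    ENNReal.tsum_sigma']
  refine tsum_congr fun j => ?_
  rw [tsum_fintype, (Commute.all a b).add_pow', ← val_smul, Finset.smul_sum, val_finset_sum,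
    Measure.finsetSum_apply, ← Finset.sum_coe_sort]
  refine Finset.sum_congr rfl fun p _ => ?_
  obtain ⟨⟨p, q⟩, hp⟩ := p
  rw [Finset.HasAntidiagonal.mem_antidiagonal] at hp
  dsimp only at hp
  subst hp
  simp only [Finset.HasAntidiagonal.sigmaAntidiagonalEquivProd_apply, smul_mul_smul_comm]
  congr 2
  rw [← Nat.cast_smul_eq_nsmul ℝ≥0∞, smul_smul]
  congr 1
  have hp : ((p.factorial : ℝ≥0∞)) ≠ 0 := by exact_mod_cast p.factorial_ne_zero
  have hq : ((q.factorial : ℝ≥0∞)) ≠ 0 := by exact_mod_cast q.factorial_ne_zero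
  rw [← ENNReal.mul_inv (.inl hp) (.inl (by finiteness)),
    ← Nat.add_choose_mul_factorial_mul_factorial]
  rw [← Nat.choose_symm_add]
  push_cast
  have hc : (((p + q).choose p : ℝ≥0∞)) ≠ 0 := by
    exact_mod_cast (Nat.choose_pos (Nat.le_add_right p q)).ne'
  rw [mul_assoc, ENNReal.mul_inv (.inl hc) (.inl (by finiteness)), mul_right_comm,
    ENNReal.inv_mul_cancel hc (by finiteness), one_mul]

end ConvMeasure

/-! ### Products, sums and independent families of measures -/

section Pi
variable {Y : Type*} [MeasurableSpace Y]

lemma lintegral_pi_fin_prod {n : ℕ} (μ : Fin n → Measure Y) [∀ i, SigmaFinite (μ i)]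
    (f : Fin n → Y → ℝ≥0∞) (hf : ∀ i, Measurable (f i)) :
    ∫⁻ y, ∏ i, f i (y i) ∂(Measure.pi μ) = ∏ i, ∫⁻ y, f i y ∂(μ i) := by
  induction n with
  | zero => simp
  | succ n ih =>
    rw [← (measurePreserving_piFinSuccAbove μ 0).symm.lintegral_comp_emb
      (MeasurableEquiv.measurableEmbedding _), Fin.prod_univ_succ]
    simp only [Fin.prod_univ_succ, MeasurableEquiv.piFinSuccAbove_symm_apply,
      Fin.insertNthEquiv_zero, Fin.consEquiv_apply, Fin.cons_zero, Fin.cons_succ,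
      Fin.zero_succAbove]
    rw [lintegral_prod_mul (f := f 0) (g := fun z : Fin n → Y => ∏ i, f i.succ (z i))
      (hf 0).aemeasurable
      (Finset.measurable_prod _ fun i _ => (hf _).comp (measurable_pi_apply i)).aemeasurable,
      ih _ _ fun i => hf _]

lemma lintegral_pi_prod {ι : Type*} [Fintype ι] (μ : ι → Measure Y) [∀ i, SigmaFinite (μ i)]
    (f : ι → Y → ℝ≥0∞) (hf : ∀ i, Measurable (f i)) :
    ∫⁻ y, ∏ i, f i (y i) ∂(Measure.pi μ) = ∏ i, ∫⁻ y, f i y ∂(μ i) := by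
  let e := (Fintype.equivFin ι).symm
  rw [← (measurePreserving_piCongrLeft μ e).lintegral_comp_emb
    (MeasurableEquiv.measurableEmbedding _), ← e.prod_comp]
  rw [← lintegral_pi_fin_prod _ _ fun i => hf _]
  refine lintegral_congr fun y => ?_
  rw [← e.prod_comp]
  simp [MeasurableEquiv.coe_piCongrLeft]

/-- Products of measures with densities have the product density. -/
lemma pi_withDensity {ι : Type*} [Fintype ι] (μ : ι → Measure Y) [∀ i, SigmaFinite (μ i)]
    (f : ι → Y → ℝ≥0∞) (hf : ∀ i, Measurable (f i))
    [∀ i, SigmaFinite ((μ i).withDensity (f i))] :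
    Measure.pi (fun i => (μ i).withDensity (f i)) =
      (Measure.pi μ).withDensity fun y => ∏ i, f i (y i) := by
  refine Measure.pi_eq fun s hs => ?_
  rw [withDensity_apply _ (MeasurableSet.univ_pi hs),
    ← lintegral_indicator (MeasurableSet.univ_pi hs)]
  have : ∀ i, (μ i).withDensity (f i) (s i) = ∫⁻ y, (s i).indicator (f i) y ∂(μ i) := fun i => by
    rw [withDensity_apply _ (hs i), lintegral_indicator (hs i)]
  simp_rw [this]
  rw [← lintegral_pi_prod _ _ fun i => (hf i).indicator (hs i)]
  refine lintegral_congr fun y => ?_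
  classical
  simp only [Set.indicator_apply, Set.mem_univ_pi]
  split_ifs with h
  · exact Finset.prod_congr rfl fun i _ => by rw [if_pos (h i)]
  · push Not at h
    obtain ⟨i, hi⟩ := h
    exact (Finset.prod_eq_zero (Finset.mem_univ i) (if_neg hi)).symm

/-- If `X` has no atoms under `μ j`, then two different coordinates of a point of a product space
almost surely have different images under `X`. -/
lemma ae_pi_ne {ι Z : Type*} [Fintype ι] [MeasurableSpace Z] [MeasurableEq Z]
    (μ : ι → Measure Y) [∀ i, SigmaFinite (μ i)] {X : Y → Z} (hX : Measurable X) {i j : ι}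
    (hij : i ≠ j) (hj : ∀ z, μ j (X ⁻¹' {z}) = 0) :
    ∀ᵐ y ∂(Measure.pi μ), X (y i) ≠ X (y j) := by
  classical
  have hm : MeasurableSet {y : ι → Y | X (y i) = X (y j)} :=
    measurableSet_eq_fun (by fun_prop) (by fun_prop)
  rw [ae_iff]
  simp only [ne_eq, not_not]
  rw [← lintegral_indicator_one hm]
  rcases isEmpty_or_nonempty (ι → Y) with h | ⟨⟨y0⟩⟩
  · simp [Measure.eq_zero_of_isEmpty]
  rw [lintegral_eq_lmarginal_univ y0, lmarginal_erase' _ (measurable_one.indicator hm)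
    (Finset.mem_univ j)]
  have h0 : (fun x : ι → Y => ∫⁻ y, {y : ι → Y | X (y i) = X (y j)}.indicator 1
      (Function.update x j y) ∂μ j) = 0 := by
    funext x
    have hs : MeasurableSet (X ⁻¹' {X (x i)}) := hX (measurableSet_singleton _)
    rw [Pi.zero_apply, ← hj (X (x i)), ← lintegral_indicator_one hs]
    refine lintegral_congr fun y => ?_
    simp [Set.indicator_apply, hij, eq_comm]
  rw [h0]
  simp [lmarginal]

/-- A random point of a product of product spaces is an independent pair of points of two product
spaces. -/
lemma lintegral_pi_prod_arrow {α β ι : Type*} [MeasurableSpace α] [MeasurableSpace β] [Fintype ι]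
    (μ : ι → Measure α) (ν : ι → Measure β) [∀ i, SigmaFinite (μ i)] [∀ i, SigmaFinite (ν i)]
    {G : (ι → α) × (ι → β) → ℝ≥0∞} (hG : Measurable G) :
    ∫⁻ y, G (fun i => (y i).1, fun i => (y i).2) ∂(Measure.pi fun i => (μ i).prod (ν i)) =
      ∫⁻ z, ∫⁻ w, G (z, w) ∂(Measure.pi ν) ∂(Measure.pi μ) := by
  rw [← lintegral_prod _ hG.aemeasurable,
    ← (measurePreserving_arrowProdEquivProdArrow α β ι μ ν).lintegral_comp hG]
  rfl

end Pi

namespace ConvMeasure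
variable {M Y : Type*} [MeasurableSpace M] [AddCommMonoid M] [MeasurableAdd₂ M] [MeasurableSpace Y]

lemma prod_of_map_fin {n : ℕ} (μ : Fin n → Measure Y) [∀ i, SigmaFinite (μ i)]
    (g : Fin n → Y → M) (hg : ∀ i, Measurable (g i)) :
    (∏ i, of ((μ i).map (g i))).val = (Measure.pi μ).map fun y => ∑ i, g i (y i) := by
  induction n with
  | zero => simp
  | succ n ih =>
    rw [Fin.prod_univ_succ, val_mul, ih _ _ fun i => hg _, val_of, Measure.conv,
      Measure.map_prod_map _ _ (hg 0) (by fun_prop), Measure.map_map (by fun_prop) (by fun_prop),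
      ← (measurePreserving_piFinSuccAbove μ 0).symm.map_eq,
      Measure.map_map (by fun_prop) (by fun_prop)]
    simp only [Fin.zero_succAbove]
    congr 1
    funext y
    simp [Fin.sum_univ_succ]

/-- The sum of independent random elements with laws `(μ i).map (g i)` has the convolution product
of these laws as its law. -/
lemma prod_of_map {ι : Type*} [Fintype ι] (μ : ι → Measure Y) [∀ i, SigmaFinite (μ i)]
    (g : ι → Y → M) (hg : ∀ i, Measurable (g i)) :
    (∏ i, of ((μ i).map (g i))).val = (Measure.pi μ).map fun y => ∑ i, g i (y i) := by
  let e := (Fintype.equivFin ι).symm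
  rw [← (measurePreserving_piCongrLeft μ e).map_eq, Measure.map_map (by fun_prop) (by fun_prop),
    ← e.prod_comp, prod_of_map_fin _ _ fun i => hg _]
  congr 1
  funext y
  simp only [Function.comp]
  rw [← e.sum_comp]
  simp [MeasurableEquiv.coe_piCongrLeft]

end ConvMeasure

/-! ### Poisson processes and completely random measures as exponentials -/

open ConvMeasure

section Atoms
variable {X Y : Type*} [MeasurableSpace X] [MeasurableSpace Y]

@[fun_prop]
lemma measurable_smul_dirac {f : Y → ℝ≥0∞} (hf : Measurable f) {g : Y → X} (hg : Measurable g) :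
    Measurable fun y => f y • Measure.dirac (g y) := by
  refine Measure.measurable_of_measurable_coe _ fun s hs => ?_
  simp only [Measure.smul_apply, smul_eq_mul]
  exact hf.mul ((Measure.measurable_coe hs).comp (Measure.measurable_dirac.comp hg))

/-- The measure `b δ_x` attached to a weight-location pair `(b, x)`. -/
noncomputable def weightedAtom (p : I × X) : Measure X :=
  ENNReal.ofReal (p.1 : ℝ) • Measure.dirac p.2

/-- The measure `n δ_x` attached to a count-location pair `(n, x)`. -/
noncomputable def countAtom (p : ℕ × X) : Measure X := (p.1 : ℝ≥0∞) • Measure.dirac p.2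

@[fun_prop]
lemma measurable_weightedAtom : Measurable (weightedAtom : I × X → Measure X) := by
  unfold weightedAtom
  fun_prop

@[fun_prop]
lemma measurable_countAtom : Measurable (countAtom : ℕ × X → Measure X) := by
  unfold countAtom
  exact measurable_smul_dirac ((measurable_from_top (f := ((↑) : ℕ → ℝ≥0∞))).comp measurable_fst)
    measurable_snd

lemma weightedSum_apply (N : Measure (I × X)) {s : Set X} (hs : MeasurableSet s) :
    weightedSum N s =
      ∫⁻ p, (Prod.snd ⁻¹' s).indicator (fun p : I × X => ENNReal.ofReal (p.1 : ℝ)) p ∂N := by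
  rw [weightedSum, Measure.map_apply measurable_snd hs, withDensity_apply _ (measurable_snd hs),
    lintegral_indicator (measurable_snd hs)]

@[fun_prop]
lemma measurable_weightedSum : Measurable (weightedSum : Measure (I × X) → Measure X) := by
  refine Measure.measurable_of_measurable_coe _ fun s hs => ?_
  simp only [weightedSum_apply _ hs]
  exact Measure.measurable_lintegral (Measurable.indicator (by fun_prop) (measurable_snd hs))

lemma weightedSum_sum_dirac {ι : Type*} [Fintype ι] (y : ι → I × X) :
    weightedSum (∑ i, Measure.dirac (y i)) = ∑ i, weightedAtom (y i) := by
  ext s hs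
  have hm : Measurable ((Prod.snd ⁻¹' s).indicator fun p : I × X => ENNReal.ofReal (p.1 : ℝ)) :=
    Measurable.indicator (by fun_prop) (measurable_snd hs)
  rw [weightedSum_apply _ hs, lintegral_finsetSum_measure, Measure.finsetSum_apply]
  refine Finset.sum_congr rfl fun i _ => ?_
  rw [lintegral_dirac' _ hm]
  by_cases h : (y i).2 ∈ s <;> simp [weightedAtom, Measure.dirac_apply' _ hs, h]

end Atoms

section CRM
variable {X : Type*} [MeasurableSpace X]

/-- The probability `e^{-λ}` that a Poisson variable of mean `λ = m univ` vanishes. -/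
noncomputable def poissonWeight {Y : Type*} [MeasurableSpace Y] (m : Measure Y) : ℝ≥0∞ :=
  ENNReal.ofReal (Real.exp (-(m Set.univ).toReal))

instance {Y : Type*} [MeasurableSpace Y] (m : Measure Y) [SigmaFinite m] :
    SFinite (poissonProcessLaw m) := by
  unfold poissonProcessLaw
  infer_instance

lemma smul_measure_sum {ι Y : Type*} [MeasurableSpace Y] (c : ℝ≥0∞) (μ : ι → Measure Y) :
    c • Measure.sum μ = Measure.sum fun i => c • μ i := by
  ext s hs
  simp [Measure.sum_apply _ hs, ENNReal.tsum_mul_left]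

lemma pow_of_map {M Y : Type*} [MeasurableSpace M] [AddCommMonoid M] [MeasurableAdd₂ M]
    [MeasurableSpace Y] (μ : Measure Y) [SigmaFinite μ] {g : Y → M} (hg : Measurable g) (j : ℕ) :
    ((of (μ.map g)) ^ j).val =
      (Measure.pi fun _ : Fin j => μ).map fun y => ∑ i, g (y i) := by
  rw [← prod_of_map _ _ fun _ => hg]
  simp

lemma ofReal_exp_div_factorial (x : ℝ) (j : ℕ) :
    ENNReal.ofReal (Real.exp x / (j.factorial : ℝ)) =
      ENNReal.ofReal (Real.exp x) * (j.factorial : ℝ≥0∞)⁻¹ := by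
  rw [ENNReal.ofReal_div_of_pos (by exact_mod_cast j.factorial_pos), ENNReal.ofReal_natCast,
    div_eq_mul_inv]

/-- An additive functional of a Poisson process has a compound Poisson law, the exponential of the
law of the contribution of one point. -/
lemma map_poissonProcessLaw {M Y : Type*} [MeasurableSpace M] [AddCommMonoid M] [MeasurableAdd₂ M]
    [MeasurableSpace Y] (m : Measure Y) [SigmaFinite m] {W : Measure Y → M} (hW : Measurable W)
    {g : Y → M} (hg : Measurable g)
    (h : ∀ (j : ℕ) (y : Fin j → Y), W (∑ i, Measure.dirac (y i)) = ∑ i, g (y i)) :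
    (poissonProcessLaw m).map W = (poissonWeight m • exp (of (m.map g))).val := by
  rw [poissonProcessLaw, Measure.map_sum (by fun_prop), val_smul, val_exp, smul_measure_sum]
  congr 1
  funext j
  have hj : Measurable fun y : Fin j → Y => ∑ i, Measure.dirac (y i) :=
    Finset.measurable_sum _ fun i _ => Measure.measurable_dirac.comp (measurable_pi_apply i)
  rw [Measure.map_smul, Measure.map_map hW hj, pow_of_map m hg, ofReal_exp_div_factorial, smul_smul]
  simp only [Function.comp_def, h, poissonWeight]

lemma map_weightedSum_poissonProcessLaw (m : Measure (I × X)) [IsFiniteMeasure m] :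
    (poissonProcessLaw m).map weightedSum =
      (poissonWeight m • exp (of (m.map weightedAtom))).val :=
  map_poissonProcessLaw m measurable_weightedSum measurable_weightedAtom
    fun _ y => weightedSum_sum_dirac y

/-- A completely random measure is a sum of independent pieces: its law is a convolution product
with one factor for each fixed atom and an exponential factor for the Poisson process. -/
lemma crmLaw_eq {κ : Type*} [Fintype κ] (m : Measure (I × X)) [IsFiniteMeasure m]
    (loc : κ → X) (h : κ → Measure I) [∀ k, IsFiniteMeasure (h k)] :
    crmLaw m loc h = (poissonWeight m •
      ((∏ k, of ((h k).map fun b => weightedAtom (b, loc k))) *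
        exp (of (m.map weightedAtom)))).val := by
  have hs : Measurable fun b : κ → I => ∑ k, weightedAtom (b k, loc k) := by fun_prop
  rw [← mul_smul_comm, val_mul, prod_of_map h _ (by fun_prop), ← map_weightedSum_poissonProcessLaw,
    Measure.conv, Measure.map_prod_map _ _ hs (by fun_prop),
    Measure.map_map (by fun_prop) (by fun_prop)]
  rfl

end CRM

/-! ### Independence of the masses of disjoint sets -/

instance {Y : Type*} [MeasurableSpace Y] (m : Measure Y) [IsFiniteMeasure m] :
    IsProbabilityMeasure (poissonProcessLaw m) := by
  refine ⟨?_⟩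
  rw [poissonProcessLaw, Measure.sum_apply _ MeasurableSet.univ]
  have hs := hasSum_one_poissonMeasure (m Set.univ).toNNReal
  have h1 : ∀ j : ℕ, 0 ≤ Real.exp (-((m Set.univ).toNNReal : ℝ)) *
      ((m Set.univ).toNNReal : ℝ) ^ j / (j.factorial : ℝ) := fun j => by positivity
  rw [← ENNReal.ofReal_one, ← hs.tsum_eq, ENNReal.ofReal_tsum_of_nonneg h1 hs.summable]
  refine tsum_congr fun j => ?_
  have hj : Measurable fun y : Fin j → Y => ∑ i, Measure.dirac (y i) :=
    Finset.measurable_sum _ fun i _ => Measure.measurable_dirac.comp (measurable_pi_apply i)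
  rw [Measure.smul_apply, Measure.map_apply hj MeasurableSet.univ, Set.preimage_univ,
    Measure.pi_univ, Finset.prod_const, Finset.card_univ, Fintype.card_fin, smul_eq_mul,
    mul_div_right_comm, ENNReal.ofReal_mul (by positivity), ENNReal.ofReal_pow (by positivity)]
  simp [ENNReal.coe_toNNReal_eq_toReal, measure_ne_top]

section CRM
variable {X : Type*} [MeasurableSpace X] {κ : Type*} [Fintype κ]

@[fun_prop]
lemma measurable_crmMap (loc : κ → X) : Measurable fun q : (κ → I) × Measure (I × X) =>
    (∑ k, ENNReal.ofReal (q.1 k : ℝ) • Measure.dirac (loc k)) + weightedSum q.2 := by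
  have h1 : Measurable fun b : κ → I => ∑ k, weightedAtom (b k, loc k) := by fun_prop
  exact (h1.comp measurable_fst).add (measurable_weightedSum.comp measurable_snd)

instance (m : Measure (I × X)) [IsFiniteMeasure m] (loc : κ → X) (h : κ → Measure I)
    [∀ k, IsProbabilityMeasure (h k)] : IsProbabilityMeasure (crmLaw m loc h) := by
  unfold crmLaw
  exact Measure.isProbabilityMeasure_map (measurable_crmMap loc).aemeasurable

lemma ae_poissonProcessLaw {Y : Type*} [MeasurableSpace Y] (m : Measure Y) [SigmaFinite m]
    {s : Set Y} (hs : MeasurableSet s) (hm : m s = 0) :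
    ∀ᵐ N ∂(poissonProcessLaw m), N s = 0 := by
  have h0 : MeasurableSet {N : Measure Y | N s = 0} :=
    Measure.measurable_coe hs (measurableSet_singleton 0)
  rw [poissonProcessLaw, Measure.ae_sum_iff' h0]
  intro j
  refine Measure.ae_smul_measure ?_ _
  have hj : Measurable fun y : Fin j → Y => ∑ i, Measure.dirac (y i) :=
    Finset.measurable_sum _ fun i _ => Measure.measurable_dirac.comp (measurable_pi_apply i)
  rw [ae_map_iff hj.aemeasurable h0]
  have : ∀ i : Fin j, ∀ᵐ y ∂(Measure.pi fun _ : Fin j => m), y i ∉ s := fun i =>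
    Measure.tendsto_eval_ae_ae.eventually (p := fun y => y ∉ s) (by simpa [ae_iff] using hm)
  filter_upwards [ae_all_iff.2 this] with y hy
  simp [Measure.finsetSum_apply, Measure.dirac_apply' _ hs, hy]

/-- A completely random measure charges no set avoiding its fixed atoms and the locations of the
Poisson points. -/
lemma ae_crmLaw_apply_eq_zero (m : Measure (I × X)) [IsFiniteMeasure m] (loc : κ → X)
    (h : κ → Measure I) [∀ k, IsFiniteMeasure (h k)] {s : Set X} (hs : MeasurableSet s)
    (hm : m (Prod.snd ⁻¹' s) = 0) (hloc : ∀ k, loc k ∉ s) :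
    ∀ᵐ μ ∂(crmLaw m loc h), μ s = 0 := by
  have h0 : MeasurableSet {μ : Measure X | μ s = 0} :=
    Measure.measurable_coe hs (measurableSet_singleton 0)
  rw [crmLaw, ae_map_iff (measurable_crmMap loc).aemeasurable h0]
  filter_upwards [Measure.quasiMeasurePreserving_snd.ae
    (ae_poissonProcessLaw m (measurable_snd hs) hm)] with q hq
  have hw : weightedSum q.2 s = 0 := by
    rw [weightedSum, Measure.map_apply measurable_snd hs]
    exact withDensity_absolutelyContinuous _ _ hq
  simp [Measure.dirac_apply' _ hs, hw, hloc]

lemma exp_zero {M : Type*} [MeasurableSpace M] [AddCommMonoid M] [MeasurableAdd₂ M] :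
    exp (0 : ConvMeasure M) = 1 := by
  ext s hs
  rw [val_exp, Measure.sum_apply _ hs, tsum_eq_single 0 (fun j hj => by simp [zero_pow hj])]
  simp

lemma exp_sum {M : Type*} [MeasurableSpace M] [AddCommMonoid M] [MeasurableAdd₂ M] {ι : Type*}
    (s : Finset ι) (a : ι → ConvMeasure M) : exp (∑ i ∈ s, a i) = ∏ i ∈ s, exp (a i) := by
  classical
  induction s using Finset.induction with
  | empty => simp [exp_zero]
  | insert i s hi ih => rw [Finset.sum_insert hi, Finset.prod_insert hi, exp_add, ih]

lemma sum_restrict_preimage {Y C : Type*} [MeasurableSpace Y] [Fintype C] (m : Measure Y)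
    (f : Y → C) (hf : ∀ c, MeasurableSet (f ⁻¹' {c})) :
    ∑ c, m.restrict (f ⁻¹' {c}) = m := by
  have hU : (⋃ c, f ⁻¹' {c}) = Set.univ := by ext; simp
  rw [← Measure.sum_fintype, ← Measure.restrict_iUnion ?_ hf, hU, Measure.restrict_univ]
  intro a b hab
  exact Disjoint.preimage _ (by simpa using hab)

variable {C : Type*} [Fintype C] [DecidableEq C]

/-- Along a finite measurable partition of the space, a completely random measure splits into
independent completely random measures, each carried by one cell. -/
lemma crmLaw_eq_prod (m : Measure (I × X)) [IsFiniteMeasure m] (loc : κ → X)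
    (h : κ → Measure I) [∀ k, IsProbabilityMeasure (h k)] (f : X → C)
    (hf : ∀ c, MeasurableSet (f ⁻¹' {c})) :
    crmLaw m loc h = (∏ c, of (crmLaw (m.restrict (Prod.snd ⁻¹' (f ⁻¹' {c})))
      (fun k : {k // f (loc k) = c} => loc k) fun k => h k)).val := by
  have hsum : ∑ c, m.restrict (Prod.snd ⁻¹' (f ⁻¹' {c})) = m :=
    sum_restrict_preimage m (f ∘ Prod.snd) fun c => measurable_snd (hf c)
  have hterm : ∀ c, of (crmLaw (m.restrict (Prod.snd ⁻¹' (f ⁻¹' {c})))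
      (fun k : {k // f (loc k) = c} => loc k) fun k => h k) =
      algebraMap ℝ≥0∞ _ (poissonWeight (m.restrict (Prod.snd ⁻¹' (f ⁻¹' {c})))) *
      ((∏ k : {k // f (loc k) = c}, of ((h k).map fun b => weightedAtom (b, loc k))) *
        exp (of ((m.restrict (Prod.snd ⁻¹' (f ⁻¹' {c}))).map weightedAtom))) := fun c => by
    ext1
    rw [val_of, crmLaw_eq, Algebra.smul_def]
  rw [crmLaw_eq]
  simp_rw [hterm]
  rw [Finset.prod_mul_distrib, Finset.prod_mul_distrib, ← exp_sum, ← map_prod,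
    Algebra.smul_def,
    Fintype.prod_fiberwise (fun k => f (loc k))
      fun k => of ((h k).map fun b => weightedAtom (b, loc k))]
  congr 2
  · congr 1
    simp only [poissonWeight]
    rw [← ENNReal.ofReal_prod_of_nonneg fun c _ => by positivity, ← Real.exp_sum]
    congr 2
    rw [Finset.sum_neg_distrib, ← ENNReal.toReal_sum fun c _ => measure_ne_top _ _]
    conv_lhs => rw [← hsum, Measure.finsetSum_apply]
  · congr 2
    ext1
    rw [val_finset_sum]
    simp only [val_of]
    rw [← Measure.map_finset_sum (by fun_prop), hsum]

/-- The masses of the cells of a finite partition are independent, since the mass of a cell is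
almost surely the mass of the factor carried by it in the splitting of the random measure. -/
lemma iIndepFun_crmLaw_preimage (m : Measure (I × X)) [IsFiniteMeasure m] (loc : κ → X)
    (h : κ → Measure I) [∀ k, IsProbabilityMeasure (h k)] (f : X → C)
    (hf : ∀ c, MeasurableSet (f ⁻¹' {c})) :
    iIndepFun (fun c (μ : Measure X) => μ (f ⁻¹' {c})) (crmLaw m loc h) := by
  set Q : C → Measure (Measure X) := fun c => crmLaw (m.restrict (Prod.snd ⁻¹' (f ⁻¹' {c})))
      (fun k : {k // f (loc k) = c} => loc k) fun k => h k with hQ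
  have hS : Measurable fun μ : C → Measure X => ∑ c, μ c := by fun_prop
  have hQm : crmLaw m loc h = (Measure.pi Q).map fun μ => ∑ c, μ c := by
    have h1 := prod_of_map Q (fun _ => id) fun _ => measurable_id
    simp only [Measure.map_id, id_eq] at h1
    rw [crmLaw_eq_prod m loc h f hf, ← h1]
  have hind : iIndepFun (fun c (μ : C → Measure X) => (∑ c', μ c') (f ⁻¹' {c})) (Measure.pi Q) := by
    have h1 := iIndepFun_pi (μ := Q) (X := fun c (μ : Measure X) => μ (f ⁻¹' {c}))
      fun c => (Measure.measurable_coe (hf c)).aemeasurable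
    refine h1.congr fun c => ?_
    have h2 : ∀ c', ∀ᵐ μ ∂(Measure.pi Q), c' ≠ c → μ c' (f ⁻¹' {c}) = 0 := fun c' => by
      refine (Measure.tendsto_eval_ae_ae (μ := Q) (i := c')).eventually
        (p := fun ν : Measure X => c' ≠ c → ν (f ⁻¹' {c}) = 0) ?_
      by_cases hc : c' = c
      · simp [hc]
      have hdis : Disjoint (f ⁻¹' {c}) (f ⁻¹' {c'}) :=
        Disjoint.preimage _ (by simpa using Ne.symm hc)
      have := ae_crmLaw_apply_eq_zero (m.restrict (Prod.snd ⁻¹' (f ⁻¹' {c'})))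
        (fun k : {k // f (loc k) = c'} => loc k) (fun k => h k) (hf c) ?_ ?_
      · filter_upwards [this] with ν hν _ using hν
      · rw [Measure.restrict_apply (measurable_snd (hf c)), ← Set.preimage_inter,
          hdis.inter_eq]
        simp
      · rintro ⟨k, hk⟩
        simp [hk, hc]
    filter_upwards [ae_all_iff.2 h2] with μ hμ
    rw [Measure.finsetSum_apply, Finset.sum_eq_single c (fun c' _ hc => hμ c' hc) (by simp)]
  rw [hQm, iIndepFun_iff_measure_inter_preimage_eq_mul]
  rw [iIndepFun_iff_measure_inter_preimage_eq_mul] at hind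
  intro S sets H
  have hSH := hind S H
  have hms : ∀ c ∈ S, MeasurableSet ((fun μ : Measure X => μ (f ⁻¹' {c})) ⁻¹' sets c) :=
    fun c hc => Measure.measurable_coe (hf c) (H c hc)
  rw [Measure.map_apply hS (S.measurableSet_biInter hms),
    Finset.prod_congr rfl fun c hc => Measure.map_apply hS (hms c hc)]
  simp only [Set.preimage_iInter]
  exact hSH

theorem isCompletelyRandom_crmLaw (m : Measure (I × X)) [IsFiniteMeasure m] (loc : κ → X)
    (h : κ → Measure I) [∀ k, IsProbabilityMeasure (h k)] :
    IsCompletelyRandom (crmLaw m loc h) := by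
  classical
  intro A hA hdis
  rw [iIndepFun_iff_finset]
  intro S
  -- the cells are the sets `A n`, `n ∈ S`, and the complement of their union
  let f : X → Option S := fun x => if hx : ∃ n : S, x ∈ A n then some hx.choose else none
  have hfs : ∀ n : S, f ⁻¹' {some n} = A n := fun n => by
    ext x
    simp only [f, Set.mem_preimage, Set.mem_singleton_iff]
    constructor
    · intro hx
      split_ifs at hx with h'
      rw [← Option.some.inj hx]
      exact h'.choose_spec
    · intro hx
      have h' : ∃ n : S, x ∈ A n := ⟨n, hx⟩
      rw [dif_pos h']
      by_contra hne
      have hne' : (h'.choose : ℕ) ≠ n := fun e => hne (by rw [Subtype.ext e])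
      exact Set.disjoint_left.1 (hdis hne') h'.choose_spec hx
  have hf : ∀ c, MeasurableSet (f ⁻¹' {c}) := by
    rintro (_ | n)
    · have : f ⁻¹' {none} = (⋃ n : S, A n)ᶜ := by
        ext x
        simp [f]
      rw [this]
      exact (MeasurableSet.iUnion fun n : S => hA n).compl
    · rw [hfs]
      exact hA n
  have := (iIndepFun_crmLaw_preimage m loc h f hf).precomp (Option.some_injective S)
  simp only [hfs] at this
  exact this

end CRM

/-! ### The law of a negative binomial process -/

/-- A family stays independent when almost surely constant random variables are added to it. -/
lemma iIndepFun_of_ae_const {ι Ω β : Type*} [MeasurableSpace Ω] [MeasurableSpace β] {Q : Measure Ω}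
    {f : ι → Ω → β} {p : ι → Prop} (h : iIndepFun (fun (i : {i // p i}) => f i) Q) (c : ι → β)
    (hc : ∀ i, ¬ p i → f i =ᵐ[Q] fun _ => c i) : iIndepFun f Q := by
  classical
  have : IsProbabilityMeasure Q := h.isProbabilityMeasure
  let g : ι → Ω → β := fun i => if p i then f i else fun _ => c i
  have hg : iIndepFun g Q := by
    rw [iIndepFun_iff_measure_inter_preimage_eq_mul] at h ⊢
    intro S sets hS
    by_cases hb : ∃ i ∈ S, ¬ p i ∧ c i ∉ sets i
    · obtain ⟨i, hi, hpi, hci⟩ := hb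
      have h0 : g i ⁻¹' sets i = ∅ := by
        ext ω
        simp [g, hpi, hci]
      rw [Finset.prod_eq_zero hi (by rw [h0, measure_empty])]
      refine measure_mono_null (Set.biInter_subset_of_mem hi) (by rw [h0, measure_empty])
    · push Not at hb
      have hu : ∀ i ∈ S, ¬ p i → g i ⁻¹' sets i = Set.univ := fun i hi hpi => by
        ext ω
        simp [g, hpi, hb i hi hpi]
      have hgf : ∀ i, p i → g i = f i := fun i hi => if_pos hi
      have h1 := h (S.subtype p) (sets := fun i => sets i)
        fun i hi => hS i (Finset.mem_subtype.1 hi)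
      have h2 : ⋂ i ∈ S, g i ⁻¹' sets i = ⋂ i ∈ S.subtype p, f i ⁻¹' sets i := by
        ext ω
        simp only [Set.mem_iInter, Finset.mem_subtype, Subtype.forall]
        constructor
        · intro hω i hpi hi
          have := hω i hi
          rwa [hgf i hpi] at this
        · intro hω i hi
          by_cases hpi : p i
          · rw [hgf i hpi]
            exact hω i hpi hi
          · rw [hu i hi hpi]
            trivial
      rw [h2, h1, Finset.prod_subtype_eq_prod_filter (s := S) (p := p)
        fun i => Q (f i ⁻¹' sets i), Finset.prod_filter]
      refine Finset.prod_congr rfl fun i hi => ?_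
      split_ifs with hpi
      · rw [hgf i hpi]
      · rw [hu i hi hpi, measure_univ]
  refine hg.congr fun i => ?_
  by_cases hpi : p i
  · simp [g, hpi]
  · simpa [g, hpi] using (hc i hpi).symm

lemma negBin_zero {r : ℝ} (hr : 0 < r) : negBin r 0 = Measure.dirac 0 := by
  ext s hs
  rw [negBin, Measure.sum_apply _ hs, tsum_eq_single 0]
  · simp [(Real.Gamma_pos_of_pos hr).ne']
  · intro k hk
    simp [hk]

section NegBin
variable {X : Type*} [MeasurableSpace X] [MeasurableSingletonClass X]

lemma sum_weightedAtom_singleton {ι : Type*} [Fintype ι] {x : ι → X} (hx : Function.Injective x)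
    (w : ι → I) (i : ι) : (∑ j, weightedAtom (w j, x j)) {x i} = ENNReal.ofReal (w i) := by
  classical
  rw [Measure.finsetSum_apply, Finset.sum_eq_single i]
  · simp [weightedAtom]
  · intro j _ hj
    simp [weightedAtom, hx.ne hj]
  · simp

/-- A negative binomial process with base measure `∑ w_i δ_{x_i}`, the `x_i` distinct, is the law of
`∑ n_i δ_{x_i}` for independent `n_i` with law `NegBin(r, w_i)`. -/
lemma IsNegBinProcess.eq_map {r : ℝ} (hr : 0 < r) {ι : Type*} [Fintype ι] {x : ι → X}
    (hx : Function.Injective x) {w : ι → I} {Q : Measure (Measure X)} [IsProbabilityMeasure Q]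
    (hQ : IsNegBinProcess r (∑ i, weightedAtom (w i, x i)) Q) :
    (∀ i, IsProbabilityMeasure (negBin r (w i))) ∧
    Q = (Measure.pi fun i => negBin r (w i)).map fun n => ∑ i, countAtom (n i, x i) := by
  classical
  set μ := ∑ i, weightedAtom (w i, x i) with hμ
  have hμx : ∀ i, μ {x i} = ENNReal.ofReal (w i) := sum_weightedAtom_singleton hx w
  have hμ0 : ∀ i, μ {x i} ≠ 0 ↔ w i ≠ 0 := fun i => by
    rw [hμx, ne_eq, ENNReal.ofReal_eq_zero, not_le]
    exact unitInterval.pos_iff_ne_zero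
  have hμe : ∀ y, μ {y} ≠ 0 → ∃ i, x i = y := fun y hy => by
    by_contra hne
    push Not at hne
    refine hy ?_
    rw [hμ, Measure.finsetSum_apply]
    exact Finset.sum_eq_zero fun i _ => by simp [weightedAtom, hne i]
  let e : {i // w i ≠ 0} ≃ {y : X // μ {y} ≠ 0} :=
    Equiv.ofBijective (fun i => ⟨x i, (hμ0 i).2 i.2⟩)
      ⟨fun i j hij => Subtype.ext (hx (congrArg Subtype.val hij)), fun y => by
        obtain ⟨i, hi⟩ := hμe y y.2
        exact ⟨⟨i, (hμ0 i).1 (hi ▸ y.2)⟩, Subtype.ext hi⟩⟩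
  have hsum : ∀ᵐ ν ∂Q, ∀ s, MeasurableSet s →
      ν s = ∑ i : {i // w i ≠ 0}, ν {x i} * Measure.dirac (x i) s := by
    filter_upwards [hQ.eq_sum] with ν hν s hs
    rw [hν, Measure.sum_apply _ hs, ← e.tsum_eq, tsum_fintype]
    rw [← hν]
    rfl
  -- a location of weight zero is not an atom of the base measure, so it receives no count
  have hzero : ∀ i, ¬ w i ≠ 0 → (fun ν : Measure X => ν {x i}) =ᵐ[Q] fun _ => 0 := by
    intro i hi
    filter_upwards [hsum] with ν hν
    rw [hν _ (measurableSet_singleton _)]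
    refine Finset.sum_eq_zero fun j _ => ?_
    have : x j ≠ x i := hx.ne fun h => hi (h ▸ j.2)
    simp [this]
  have hmf : ∀ i, Measurable fun ν : Measure X => ν {x i} := fun i =>
    Measure.measurable_coe (measurableSet_singleton _)
  have hind : iIndepFun (fun i (ν : Measure X) => ν {x i}) Q :=
    iIndepFun_of_ae_const (p := fun i => w i ≠ 0) (hQ.indep.precomp e.injective) (fun _ => 0) hzero
  have hcast : Measurable fun k : ℕ => (k : ℝ≥0∞) := measurable_from_top
  have hlaw : ∀ i, Q.map (fun ν => ν {x i}) =
      (negBin r (w i)).map fun k : ℕ => (k : ℝ≥0∞) := fun i => by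
    by_cases hi : w i = 0
    · rw [Measure.map_congr (hzero i (not_not.2 hi)), hi, Set.Icc.coe_zero, negBin_zero hr,
        Measure.map_dirac' hcast, Measure.map_const]
      simp
    · rw [hQ.law _ ((hμ0 i).2 hi), hμx, ENNReal.toReal_ofReal (w i).2.1]
  -- `negBin r 1` is the zero measure, so the hypothesis on the counts excludes the weight `1`
  have hprob : ∀ i, IsProbabilityMeasure (negBin r (w i)) := fun i => by
    refine ⟨?_⟩
    have h1 : Q.map (fun ν => ν {x i}) Set.univ = 1 := by
      rw [Measure.map_apply (hmf i) MeasurableSet.univ, Set.preimage_univ, measure_univ]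
    rwa [hlaw, Measure.map_apply hcast MeasurableSet.univ, Set.preimage_univ] at h1
  refine ⟨hprob, ?_⟩
  have hmD : Measurable fun f : ι → ℝ≥0∞ => ∑ i, f i • Measure.dirac (x i) :=
    Finset.measurable_sum _ fun i _ =>
      measurable_smul_dirac (measurable_pi_apply i) measurable_const
  have hid : (fun ν : Measure X => ∑ i, ν {x i} • Measure.dirac (x i)) =ᵐ[Q] id := by
    filter_upwards [hsum, ae_all_iff.2 fun i => (Filter.eventually_imp_distrib_left.2 (hzero i))]
      with ν hν h0
    ext s hs
    have h1 : ∀ i ∈ Finset.univ, (ν {x i} • Measure.dirac (x i)) s ≠ 0 → w i ≠ 0 :=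
      fun i _ hi => by
        by_contra hw
        exact hi (by simp [h0 i (not_not.2 hw)])
    rw [id, hν s hs, Measure.finsetSum_apply, ← Finset.sum_filter_of_ne h1]
    exact Finset.sum_subtype _ (by simp) _
  calc Q = Q.map (fun ν : Measure X => ∑ i, ν {x i} • Measure.dirac (x i)) := by
        rw [Measure.map_congr hid, Measure.map_id]
    _ = (Q.map fun ν i => ν {x i}).map fun f => ∑ i, f i • Measure.dirac (x i) := by
        rw [Measure.map_map hmD (measurable_pi_lambda _ hmf)]
        rfl
    _ = _ := by
        have hσ : ∀ i, SigmaFinite ((negBin r (w i)).map fun k : ℕ => (k : ℝ≥0∞)) := fun i => by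
          rw [← hlaw]
          infer_instance
        rw [hind.map_fun_eq_pi_map fun i => (hmf i).aemeasurable]
        simp_rw [hlaw]
        rw [← Measure.pi_map_pi fun i => hcast.aemeasurable, Measure.map_map hmD (by fun_prop)]
        rfl

end NegBin

/-! ### The joint law of the random measure and of its counts -/

/-- The mass `Γ(k + r) / (k! Γ(r)) (1 - b)^r b^k` of `NegBin(r, b)` at `k`. -/
noncomputable def negBinMass (r : ℝ) (b : I) (k : ℕ) : ℝ≥0∞ :=
  ENNReal.ofReal
    (Real.Gamma (k + r) / (k.factorial * Real.Gamma r) * (1 - (b : ℝ)) ^ r * (b : ℝ) ^ k)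

@[fun_prop]
lemma measurable_negBinMass (r : ℝ) : Measurable fun p : I × ℕ => negBinMass r p.1 p.2 := by
  refine measurable_from_prod_countable_left fun k => ?_
  unfold negBinMass
  have : Measurable fun b : I => (1 - (b : ℝ)) ^ r :=
    (measurable_const.sub measurable_subtype_coe).pow_const r
  have h2 : Measurable fun b : I => (b : ℝ) ^ k := measurable_subtype_coe.pow_const k
  exact ((this.const_mul (Real.Gamma (k + r) / (k.factorial * Real.Gamma r))).mul h2).ennreal_ofReal

lemma negBinMass_ne_top (r : ℝ) (b : I) (k : ℕ) : negBinMass r b k ≠ ∞ := ENNReal.ofReal_ne_top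

lemma negBin_eq_withDensity (r : ℝ) (b : I) :
    negBin r b = Measure.count.withDensity (negBinMass r b) := by
  ext s hs
  rw [negBin, Measure.sum_apply _ hs, withDensity_apply _ hs, ← lintegral_indicator hs,
    lintegral_count]
  refine tsum_congr fun k => ?_
  by_cases hk : k ∈ s <;> simp [hk, negBinMass]

section Joint
variable {X : Type*} [MeasurableSpace X]

/-- The measure `NegBin(r, b)(n) η(d(b, x)) c(dn)` on triples of a weight, a location and a count.
For `c` the counting measure it is the law of a weight-location pair of law `η` together with a
count which is negative binomial given the weight. -/
noncomputable def markedLaw (r : ℝ) (η : Measure (I × X)) (c : Measure ℕ) :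
    Measure ((I × X) × ℕ) :=
  (η.prod c).withDensity fun p => negBinMass r p.1.1 p.2

instance (r : ℝ) (η : Measure (I × X)) [SigmaFinite η] (c : Measure ℕ) [SigmaFinite c] :
    SigmaFinite (markedLaw r η c) :=
  SigmaFinite.withDensity_of_ne_top (.of_forall fun _ => negBinMass_ne_top _ _ _)

/-- The pair `(n δ_x, b δ_x)` of contributions of an atom at `x` with weight `b` and count `n`. -/
noncomputable def atomPair (p : (I × X) × ℕ) : Measure X × Measure X :=
  (countAtom (p.2, p.1.2), weightedAtom p.1)

@[fun_prop]
lemma measurable_atomPair : Measurable (atomPair : (I × X) × ℕ → Measure X × Measure X) := by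
  unfold atomPair
  fun_prop

lemma measurable_prod_negBinMass {ι : Type*} [Fintype ι] (r : ℝ) :
    Measurable fun p : (ι → I × X) × (ι → ℕ) => ∏ i, negBinMass r (p.1 i).1 (p.2 i) :=
  Finset.measurable_prod _ fun i _ => (measurable_negBinMass r).comp
    (f := fun p : (ι → I × X) × (ι → ℕ) => ((p.1 i).1, p.2 i)) (by fun_prop)

lemma pi_markedLaw {ι : Type*} [Fintype ι] (r : ℝ) (η : ι → Measure (I × X))
    [∀ i, IsFiniteMeasure (η i)] :
    Measure.pi (fun i => markedLaw r (η i) Measure.count) =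
      (Measure.pi fun i => (η i).prod Measure.count).withDensity
        fun y => ∏ i, negBinMass r (y i).1.1 (y i).2 := by
  have hnb : Measurable fun p : (I × X) × ℕ => negBinMass r p.1.1 p.2 :=
    (measurable_negBinMass r).comp (f := fun p : (I × X) × ℕ => (p.1.1, p.2)) (by fun_prop)
  have hσ : ∀ i, SigmaFinite
      (((η i).prod Measure.count).withDensity fun p => negBinMass r p.1.1 p.2) :=
    fun i => inferInstanceAs (SigmaFinite (markedLaw r (η i) Measure.count))
  exact pi_withDensity _ _ fun _ => hnb

lemma lintegral_pi_markedLaw {ι : Type*} [Fintype ι] (r : ℝ) (η : ι → Measure (I × X))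
    [∀ i, IsFiniteMeasure (η i)] {F : (ι → I × X) × (ι → ℕ) → ℝ≥0∞} (hF : Measurable F) :
    ∫⁻ y, F (fun i => (y i).1, fun i => (y i).2)
        ∂(Measure.pi fun i => markedLaw r (η i) Measure.count) =
      ∫⁻ z, ∫⁻ n, (∏ i, negBinMass r (z i).1 (n i)) * F (z, n)
        ∂(Measure.pi fun _ => Measure.count) ∂(Measure.pi η) := by
  have hD := measurable_prod_negBinMass (X := X) (ι := ι) r
  have hm : Measurable fun y : ι → (I × X) × ℕ => (fun i => (y i).1, fun i => (y i).2) := by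
    fun_prop
  have hDm : Measurable fun y : ι → (I × X) × ℕ => ∏ i, negBinMass r (y i).1.1 (y i).2 :=
    Finset.measurable_prod _ fun i _ => (measurable_negBinMass r).comp
      (f := fun y : ι → (I × X) × ℕ => ((y i).1.1, (y i).2)) (by fun_prop)
  have hFm : Measurable fun y : ι → (I × X) × ℕ => F (fun i => (y i).1, fun i => (y i).2) :=
    hF.comp hm
  rw [pi_markedLaw, lintegral_withDensity_eq_lintegral_mul _ hDm hFm]
  exact lintegral_pi_prod_arrow η (fun _ => Measure.count) (hD.mul hF)

lemma lintegral_pi_negBin {ι : Type*} [Fintype ι] (r : ℝ) (w : ι → I)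
    [∀ i, IsProbabilityMeasure (negBin r (w i))] (F : (ι → ℕ) → ℝ≥0∞) :
    ∫⁻ n, F n ∂(Measure.pi fun i => negBin r (w i)) =
      ∫⁻ n, (∏ i, negBinMass r (w i) (n i)) * F n ∂(Measure.pi fun _ => Measure.count) := by
  have hσ : ∀ i, SigmaFinite (Measure.count.withDensity (negBinMass r (w i))) := fun i => by
    rw [← negBin_eq_withDensity]
    infer_instance
  simp_rw [negBin_eq_withDensity]
  rw [pi_withDensity _ _ fun i => measurable_from_top,
    lintegral_withDensity_eq_lintegral_mul _ (Measurable.of_discrete)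
      (Measurable.of_discrete)]
  rfl

/-- The joint law of the counts and of a random measure with finitely many independent labelled
atoms: each atom contributes one convolution factor, the law of its pair `(n δ_x, b δ_x)`. -/
lemma map_swap_compProd_eq_prod {ι : Type*} [Fintype ι] (r : ℝ) (η : ι → Measure (I × X))
    [∀ i, IsFiniteMeasure (η i)] (K : Kernel (Measure X) (Measure X)) [IsSFiniteKernel K]
    (hK : ∀ᵐ z ∂(Measure.pi η), (∀ i, IsProbabilityMeasure (negBin r (z i).1)) ∧
      K (∑ i, weightedAtom (z i)) =
        (Measure.pi fun i => negBin r (z i).1).map fun n => ∑ i, countAtom (n i, (z i).2)) :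
    (((Measure.pi η).map fun z => ∑ i, weightedAtom (z i)) ⊗ₘ K).map Prod.swap =
      (∏ i, of ((markedLaw r (η i) Measure.count).map atomPair)).val := by
  refine Measure.ext_of_lintegral _ fun F hF => ?_
  have hG : Measurable fun z : ι → I × X => ∑ i, weightedAtom (z i) :=
    Finset.measurable_sum _ fun i _ => measurable_weightedAtom.comp (measurable_pi_apply i)
  have hF' : Measurable fun p : (ι → I × X) × (ι → ℕ) =>
      F (∑ i, countAtom (p.2 i, (p.1 i).2), ∑ i, weightedAtom (p.1 i)) :=
    hF.comp ((Finset.measurable_sum _ fun i _ => measurable_countAtom.comp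
      (f := fun p : (ι → I × X) × (ι → ℕ) => (p.2 i, (p.1 i).2)) (by fun_prop)).prodMk
      (hG.comp measurable_fst))
  have hS : Measurable fun y : ι → (I × X) × ℕ => ∑ i, atomPair (y i) :=
    Finset.measurable_sum _ fun i _ => measurable_atomPair.comp (measurable_pi_apply i)
  rw [prod_of_map _ _ fun _ => measurable_atomPair, lintegral_map hF hS,
    lintegral_map hF measurable_swap,
    Measure.lintegral_compProd (f := fun p => F p.swap) (hF.comp measurable_swap),
    lintegral_map (Measurable.lintegral_kernel_prod_right' (f := fun p => F p.swap)
      (hF.comp measurable_swap)) hG]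
  have h2 : ∀ y : ι → (I × X) × ℕ, ∑ i, atomPair (y i) =
      (∑ i, countAtom ((y i).2, (y i).1.2), ∑ i, weightedAtom (y i).1) := fun y =>
    Prod.ext (by simp [Prod.fst_sum, atomPair]) (by simp [Prod.snd_sum, atomPair])
  simp_rw [h2]
  rw [lintegral_pi_markedLaw r η hF']
  refine lintegral_congr_ae ?_
  filter_upwards [hK] with z ⟨hz, hKz⟩
  rw [hKz, lintegral_map (f := fun b => F (∑ i, weightedAtom (z i), b).swap)
    (hF.comp (measurable_swap.comp measurable_prodMk_left)) (Measurable.of_discrete),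
    lintegral_pi_negBin]
  rfl

/-- Laws of the weight-location pairs behind a completely random measure conditioned on its Poisson
process having `j` points: the fixed atoms come first, the Poisson points follow. -/
noncomputable def pairLaw {κ : Type*} (m : Measure (I × X)) (loc : κ → X) (h : κ → Measure I)
    (j : ℕ) : κ ⊕ Fin j → Measure (I × X) :=
  Sum.elim (fun k => (h k).prod (Measure.dirac (loc k))) fun _ => m

instance {κ : Type*} (m : Measure (I × X)) [IsFiniteMeasure m] (loc : κ → X) (h : κ → Measure I)
    [∀ k, IsFiniteMeasure (h k)] (j : ℕ) (i : κ ⊕ Fin j) :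
    IsFiniteMeasure (pairLaw m loc h j i) := by
  rcases i with k | i <;> simp only [pairLaw, Sum.elim_inl, Sum.elim_inr] <;> infer_instance

/-- A completely random measure, disintegrated along the number `j` of its Poisson points. -/
lemma crmLaw_eq_sum {κ : Type*} [Fintype κ] (m : Measure (I × X)) [IsFiniteMeasure m]
    (loc : κ → X) (h : κ → Measure I) [∀ k, IsFiniteMeasure (h k)] :
    crmLaw m loc h = Measure.sum fun j : ℕ => (poissonWeight m * (j.factorial : ℝ≥0∞)⁻¹) •
      (Measure.pi (pairLaw m loc h j)).map fun z => ∑ i, weightedAtom (z i) := by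
  have hfix : ∀ k, of ((h k).map fun b => weightedAtom (b, loc k)) =
      of (((h k).prod (Measure.dirac (loc k))).map weightedAtom) := fun k => by
    ext1
    rw [val_of, val_of, Measure.prod_dirac, Measure.map_map (by fun_prop) (by fun_prop)]
    rfl
  rw [crmLaw_eq, exp, val_smul, mul_val_sum, smul_measure_sum]
  congr 1
  funext j
  have hpow : ∏ i : Fin j, of ((pairLaw m loc h j (.inr i)).map weightedAtom) =
      of (m.map weightedAtom) ^ j :=
    (Finset.prod_const (s := (Finset.univ : Finset (Fin j))) (of (m.map weightedAtom))).trans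
      (by rw [Finset.card_univ, Fintype.card_fin])
  rw [← prod_of_map (pairLaw m loc h j) _ fun _ => measurable_weightedAtom, Fintype.prod_sum_type,
    mul_smul_comm, val_smul, smul_smul, hpow]
  simp only [pairLaw, hfix, Sum.elim_inl]

/-- The joint law of the counts and of the random measure is again a convolution product, with one
factor for each fixed atom and an exponential factor for the Poisson process. -/
lemma map_swap_crmLaw_compProd {κ : Type*} [Fintype κ] [MeasurableSingletonClass X]
    [MeasurableEq X] {r : ℝ}
    (hr : 0 < r) (m : Measure (I × X)) [IsFiniteMeasure m] (hm : ∀ x, m (Prod.snd ⁻¹' {x}) = 0)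
    {loc : κ → X} (hloc : Function.Injective loc) (h : κ → Measure I)
    [∀ k, IsProbabilityMeasure (h k)] (K : Kernel (Measure X) (Measure X)) [IsMarkovKernel K]
    (hK : ∀ᵐ μ ∂(crmLaw m loc h), IsNegBinProcess r μ (K μ)) :
    (crmLaw m loc h ⊗ₘ K).map Prod.swap = (poissonWeight m •
      ((∏ k, of ((markedLaw r ((h k).prod (Measure.dirac (loc k))) Measure.count).map atomPair)) *
        exp (of ((markedLaw r m Measure.count).map atomPair)))).val := by
  have hw : poissonWeight m ≠ 0 := by simp [poissonWeight, Real.exp_pos]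
  rw [crmLaw_eq_sum, Measure.ae_sum_iff] at hK
  have hterm : ∀ j,
      (((Measure.pi (pairLaw m loc h j)).map fun z => ∑ i, weightedAtom (z i)) ⊗ₘ K).map Prod.swap =
        (∏ i, of ((markedLaw r (pairLaw m loc h j i) Measure.count).map atomPair)).val := by
    intro j
    refine map_swap_compProd_eq_prod r _ K ?_
    have h1 := hK j
    have hj : poissonWeight m * (j.factorial : ℝ≥0∞)⁻¹ ≠ 0 :=
      mul_ne_zero hw (ENNReal.inv_ne_zero.2 (ENNReal.natCast_ne_top _))
    rw [Measure.ae_ennreal_smul_measure_iff hj] at h1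
    have h2 := ae_of_ae_map (Finset.measurable_sum _ fun i _ =>
      measurable_weightedAtom.comp (measurable_pi_apply i)).aemeasurable h1
    have hfix : ∀ k : κ, ∀ᵐ z ∂(Measure.pi (pairLaw m loc h j)),
        (z (.inl k)).2 = loc k := fun k => by
      refine (Measure.tendsto_eval_ae_ae (μ := pairLaw m loc h j) (i := .inl k)).eventually
        (p := fun p => p.2 = loc k) ?_
      simp only [pairLaw, Sum.elim_inl]
      have h0 : MeasurableSet {p : I × X | p.2 = loc k} :=
        measurable_snd (measurableSet_singleton (loc k))
      rw [Measure.prod_dirac, ae_map_iff (by fun_prop) h0]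
      simp
    have hne : ∀ (a : κ ⊕ Fin j) (i : Fin j), ∀ᵐ z ∂(Measure.pi (pairLaw m loc h j)),
        a ≠ .inr i → (z a).2 ≠ (z (.inr i)).2 := fun a i => by
      by_cases hai : a = .inr i
      · simp [hai]
      · filter_upwards [ae_pi_ne (pairLaw m loc h j) measurable_snd hai hm] with z hz _ using hz
    filter_upwards [h2, ae_all_iff.2 hfix, ae_all_iff.2 fun a => ae_all_iff.2 (hne a)]
      with z hz hzf hzn
    have hinj : Function.Injective fun a => (z a).2 := by
      rintro (a | a) (b | b) hab
      · simp only [hzf] at hab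
        rw [hloc hab]
      · exact absurd hab (hzn _ _ (by simp))
      · exact absurd hab.symm (hzn _ _ (by simp))
      · by_contra hne
        exact hzn _ _ hne hab
    exact hz.eq_map hr hinj
  rw [crmLaw_eq_sum, Measure.compProd_sum_left, Measure.map_sum (by fun_prop), exp, val_smul,
    mul_val_sum, smul_measure_sum]
  congr 1
  funext j
  rw [Measure.compProd_smul_left, Measure.map_smul, hterm, Fintype.prod_sum_type,
    mul_smul_comm, val_smul, smul_smul]
  have hpow : ∏ i : Fin j,
      of ((markedLaw r (pairLaw m loc h j (.inr i)) Measure.count).map atomPair) =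
      of ((markedLaw r m Measure.count).map atomPair) ^ j :=
    (Finset.prod_const (s := (Finset.univ : Finset (Fin j)))
      (of ((markedLaw r m Measure.count).map atomPair))).trans
      (by rw [Finset.card_univ, Fintype.card_fin])
  rw [hpow]
  rfl

end Joint

/-! ### Tilting the weights by the likelihood of the counts -/

/-- The factor `Γ(k + r) / (k! Γ(r))` in the negative binomial masses. -/
noncomputable def negBinCoeff (r : ℝ) (k : ℕ) : ℝ≥0∞ :=
  ENNReal.ofReal (Real.Gamma (k + r) / (k.factorial * Real.Gamma r))

/-- The mass `∫ NegBin(r, b)(k) ρ(db)` of the count `k` at an atom whose weight has law `ρ`. -/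
noncomputable def countMass (r : ℝ) (ρ : Measure I) (k : ℕ) : ℝ≥0∞ :=
  negBinCoeff r k * reweight r k ρ Set.univ

lemma measurable_reweightDensity (r : ℝ) (k : ℕ) :
    Measurable fun b : I => ENNReal.ofReal ((1 - (b : ℝ)) ^ r * (b : ℝ) ^ k) := by
  have h1 : Measurable fun b : I => (1 - (b : ℝ)) ^ r :=
    (measurable_const.sub measurable_subtype_coe).pow_const r
  have h2 : Measurable fun b : I => (b : ℝ) ^ k := measurable_subtype_coe.pow_const k
  exact (h1.mul h2).ennreal_ofReal

lemma isFiniteMeasure_reweight {r : ℝ} (hr : 0 < r) (k : ℕ) (ρ : Measure I) [IsFiniteMeasure ρ] :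
    IsFiniteMeasure (reweight r k ρ) := by
  refine isFiniteMeasure_withDensity (ne_of_lt ?_)
  refine lt_of_le_of_lt (lintegral_mono (g := fun _ => 1) fun b => ?_) (by simp)
  rw [← ENNReal.ofReal_one]
  refine ENNReal.ofReal_le_ofReal (mul_le_one₀ ?_ (by have := b.2.1; positivity) ?_)
  · exact Real.rpow_le_one (sub_nonneg.2 b.2.2) (by linarith [b.2.1]) hr.le
  · exact pow_le_one₀ b.2.1 b.2.2

lemma reweight_eq_smul_tilt {r : ℝ} (hr : 0 < r) (k : ℕ) (ρ : Measure I) [IsFiniteMeasure ρ] :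
    reweight r k ρ = reweight r k ρ Set.univ • tilt r k ρ := by
  have := isFiniteMeasure_reweight hr k ρ
  by_cases h : reweight r k ρ Set.univ = 0
  · rw [h, zero_smul]
    exact Measure.measure_univ_eq_zero.1 h
  · rw [tilt, smul_smul, ENNReal.mul_inv_cancel h (measure_ne_top _ _), one_smul]

lemma isFiniteMeasure_tilt {r : ℝ} (hr : 0 < r) (k : ℕ) (ρ : Measure I) [IsFiniteMeasure ρ] :
    IsFiniteMeasure (tilt r k ρ) := by
  have := isFiniteMeasure_reweight hr k ρ
  refine ⟨?_⟩
  rw [tilt, Measure.smul_apply, smul_eq_mul]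
  by_cases h : reweight r k ρ Set.univ = 0
  · simp [h]
  · rw [ENNReal.inv_mul_cancel h (measure_ne_top _ _)]
    exact ENNReal.one_lt_top

lemma isProbabilityMeasure_tilt {r : ℝ} (hr : 0 < r) (k : ℕ) (ρ : Measure I) [IsFiniteMeasure ρ]
    (h : reweight r k ρ Set.univ ≠ 0) : IsProbabilityMeasure (tilt r k ρ) := by
  have := isFiniteMeasure_reweight hr k ρ
  exact ⟨by
    rw [tilt, Measure.smul_apply, smul_eq_mul, ENNReal.inv_mul_cancel h (measure_ne_top _ _)]⟩

lemma negBinMass_eq {r : ℝ} (hr : 0 < r) (b : I) (k : ℕ) :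
    negBinMass r b k =
      negBinCoeff r k * ENNReal.ofReal ((1 - (b : ℝ)) ^ r * (b : ℝ) ^ k) := by
  have h : 0 ≤ Real.Gamma (k + r) / (k.factorial * Real.Gamma r) := by
    have h1 := Real.Gamma_pos_of_pos hr
    have h2 : 0 < Real.Gamma (k + r) := Real.Gamma_pos_of_pos (by positivity)
    positivity
  rw [negBinMass, negBinCoeff, ← ENNReal.ofReal_mul h, mul_assoc]

/-- Bayes' rule for a single atom: weighting the law of the weight by the probability of the count
`k` gives the tilted law, times the mass of `k`. -/
lemma withDensity_negBinMass {r : ℝ} (hr : 0 < r) (k : ℕ) (ρ : Measure I) [IsFiniteMeasure ρ] :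
    ρ.withDensity (fun b => negBinMass r b k) = countMass r ρ k • tilt r k ρ := by
  simp_rw [negBinMass_eq hr]
  rw [countMass, ← smul_smul, ← reweight_eq_smul_tilt hr, reweight,
    ← withDensity_smul _ (measurable_reweightDensity r k)]
  rfl

lemma countMass_ne_top {r : ℝ} (hr : 0 < r) (ρ : Measure I) [IsFiniteMeasure ρ] (k : ℕ) :
    countMass r ρ k ≠ ∞ := by
  have := isFiniteMeasure_reweight hr k ρ
  exact ENNReal.mul_ne_top ENNReal.ofReal_ne_top (measure_ne_top _ _)

lemma pi_smul {ι Y : Type*} [Fintype ι] [MeasurableSpace Y] (c : ι → ℝ≥0∞) (hc : ∀ i, c i ≠ ∞)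
    (μ : ι → Measure Y) [∀ i, IsFiniteMeasure (μ i)] :
    Measure.pi (fun i => c i • μ i) = (∏ i, c i) • Measure.pi μ := by
  have : ∀ i, IsFiniteMeasure (c i • μ i) := fun i => Measure.smul_finite _ (hc i)
  refine Measure.pi_eq fun s _ => ?_
  simp [Finset.prod_mul_distrib]

section
variable {X : Type*} [MeasurableSpace X]

/-- The pair `(n δ_x, b δ_x)`, for a count-location pair `(n, x)` and a weight `b`. -/
noncomputable def labelPair (p : (ℕ × X) × I) : Measure X × Measure X :=
  (countAtom p.1, weightedAtom (p.2, p.1.2))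

@[fun_prop]
lemma measurable_labelPair : Measurable (labelPair : (ℕ × X) × I → Measure X × Measure X) :=
  (measurable_countAtom.comp measurable_fst).prodMk
    (measurable_weightedAtom.comp (f := fun p : (ℕ × X) × I => (p.2, p.1.2)) (by fun_prop))

/-- The measure `markedLaw r (ρ × α) c` with the roles of weight and count exchanged. -/
noncomputable def labelLaw (r : ℝ) (c : Measure ℕ) (α : Measure X) (ρ : Measure I) :
    Measure ((ℕ × X) × I) :=
  ((c.prod α).prod ρ).withDensity fun p => negBinMass r p.2 p.1.1

instance (r : ℝ) (c : Measure ℕ) (α : Measure X) (ρ : Measure I) [SigmaFinite c] [SigmaFinite α]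
    [SigmaFinite ρ] : SigmaFinite (labelLaw r c α ρ) :=
  SigmaFinite.withDensity_of_ne_top (.of_forall fun _ => negBinMass_ne_top _ _ _)

lemma map_markedLaw_eq_map_labelLaw (r : ℝ) (c : Measure ℕ) (α : Measure X) (ρ : Measure I)
    [SFinite c] [SFinite α] [SFinite ρ] :
    (markedLaw r (ρ.prod α) c).map atomPair = (labelLaw r c α ρ).map labelPair := by
  refine Measure.ext_of_lintegral _ fun F hF => ?_
  have h1 : Measurable fun p : (I × X) × ℕ => negBinMass r p.1.1 p.2 :=
    (measurable_negBinMass r).comp (f := fun p : (I × X) × ℕ => (p.1.1, p.2)) (by fun_prop)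
  have h2 : Measurable fun p : (ℕ × X) × I => negBinMass r p.2 p.1.1 :=
    (measurable_negBinMass r).comp (f := fun p : (ℕ × X) × I => (p.2, p.1.1)) (by fun_prop)
  have hG : Measurable fun p : (ℕ × X) × I => negBinMass r p.2 p.1.1 * F (labelPair p) :=
    h2.mul (hF.comp measurable_labelPair)
  rw [lintegral_map hF measurable_atomPair, lintegral_map hF measurable_labelPair, markedLaw,
    labelLaw,
    lintegral_withDensity_eq_lintegral_mul _ h1 (g := fun p => F (atomPair p))
      (hF.comp measurable_atomPair),
    lintegral_withDensity_eq_lintegral_mul _ h2 (g := fun p => F (labelPair p))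
      (hF.comp measurable_labelPair)]
  let e : (I × X) × ℕ → (ℕ × X) × I := fun p => ((p.2, p.1.2), p.1.1)
  have he : Measurable e := by fun_prop
  have hmap : ((ρ.prod α).prod c).map e = (c.prod α).prod ρ := by
    refine Measure.ext_of_lintegral _ fun f hf => ?_
    have hfe : Measurable fun p => f (e p) := hf.comp he
    rw [lintegral_map hf he, lintegral_prod_symm _ hfe.aemeasurable,
      lintegral_prod _ hf.aemeasurable, lintegral_prod _ hf.lintegral_prod_right'.aemeasurable]
    refine lintegral_congr fun n => ?_
    have hn : Measurable fun p : I × X => f (e (p, n)) := hfe.comp measurable_prodMk_right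
    rw [lintegral_prod_symm _ hn.aemeasurable]
  rw [← hmap, lintegral_map (by exact hG) he]
  rfl

lemma pi_labelLaw {ι : Type*} [Fintype ι] (r : ℝ) (c : ι → Measure ℕ) (α : ι → Measure X)
    (ρ : ι → Measure I) [∀ i, SigmaFinite (c i)] [∀ i, SigmaFinite (α i)]
    [∀ i, IsFiniteMeasure (ρ i)] :
    Measure.pi (fun i => labelLaw r (c i) (α i) (ρ i)) =
      (Measure.pi fun i => ((c i).prod (α i)).prod (ρ i)).withDensity
        fun y => ∏ i, negBinMass r (y i).2 (y i).1.1 := by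
  have hnb : Measurable fun p : (ℕ × X) × I => negBinMass r p.2 p.1.1 :=
    (measurable_negBinMass r).comp (f := fun p : (ℕ × X) × I => (p.2, p.1.1)) (by fun_prop)
  have hσ : ∀ i, SigmaFinite
      ((((c i).prod (α i)).prod (ρ i)).withDensity fun p => negBinMass r p.2 p.1.1) :=
    fun i => inferInstanceAs (SigmaFinite (labelLaw r (c i) (α i) (ρ i)))
  exact pi_withDensity _ _ fun _ => hnb

lemma lintegral_pi_labelLaw {ι : Type*} [Fintype ι] (r : ℝ) (c : ι → Measure ℕ)
    (α : ι → Measure X) (ρ : ι → Measure I) [∀ i, SigmaFinite (c i)] [∀ i, SigmaFinite (α i)]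
    [∀ i, IsFiniteMeasure (ρ i)] {F : (ι → ℕ × X) × (ι → I) → ℝ≥0∞} (hF : Measurable F) :
    ∫⁻ y, F (fun i => (y i).1, fun i => (y i).2)
        ∂(Measure.pi fun i => labelLaw r (c i) (α i) (ρ i)) =
      ∫⁻ y, ∫⁻ b, (∏ i, negBinMass r (b i) (y i).1) * F (y, b) ∂(Measure.pi ρ)
        ∂(Measure.pi fun i => (c i).prod (α i)) := by
  have hD : Measurable fun p : (ι → ℕ × X) × (ι → I) => ∏ i, negBinMass r (p.2 i) (p.1 i).1 :=
    Finset.measurable_prod _ fun i _ => (measurable_negBinMass r).comp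
      (f := fun p : (ι → ℕ × X) × (ι → I) => (p.2 i, (p.1 i).1)) (by fun_prop)
  have hm : Measurable fun y : ι → (ℕ × X) × I => (fun i => (y i).1, fun i => (y i).2) := by
    fun_prop
  have hDm : Measurable fun y : ι → (ℕ × X) × I => ∏ i, negBinMass r (y i).2 (y i).1.1 :=
    Finset.measurable_prod _ fun i _ => (measurable_negBinMass r).comp
      (f := fun y : ι → (ℕ × X) × I => ((y i).2, (y i).1.1)) (by fun_prop)
  have hFm : Measurable fun y : ι → (ℕ × X) × I => F (fun i => (y i).1, fun i => (y i).2) :=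
    hF.comp hm
  rw [pi_labelLaw, lintegral_withDensity_eq_lintegral_mul _ hDm hFm]
  exact lintegral_pi_prod_arrow (fun i => (c i).prod (α i)) ρ (hD.mul hF)

/-- Bayes' rule for several independent atoms. -/
lemma lintegral_prod_negBinMass {ι : Type*} [Fintype ι] {r : ℝ} (hr : 0 < r) (n : ι → ℕ)
    (ρ : ι → Measure I) [∀ i, IsFiniteMeasure (ρ i)] {G : (ι → I) → ℝ≥0∞} (hG : Measurable G) :
    ∫⁻ b, (∏ i, negBinMass r (b i) (n i)) * G b ∂(Measure.pi ρ) =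
      (∏ i, countMass r (ρ i) (n i)) * ∫⁻ b, G b ∂(Measure.pi fun i => tilt r (n i) (ρ i)) := by
  have hnb : ∀ i, Measurable fun b : I => negBinMass r b (n i) := fun i =>
    (measurable_negBinMass r).comp (f := fun b : I => (b, n i)) (by fun_prop)
  have hD : Measurable fun b : ι → I => ∏ i, negBinMass r (b i) (n i) :=
    Finset.measurable_prod _ fun i _ => (hnb i).comp (measurable_pi_apply i)
  have hfin : ∀ i, IsFiniteMeasure (tilt r (n i) (ρ i)) := fun i => isFiniteMeasure_tilt hr _ _
  have hσ : ∀ i, SigmaFinite ((ρ i).withDensity fun b => negBinMass r b (n i)) := fun i =>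
    SigmaFinite.withDensity_of_ne_top (.of_forall fun _ => negBinMass_ne_top _ _ _)
  have h1 : (Measure.pi ρ).withDensity (fun b => ∏ i, negBinMass r (b i) (n i)) =
      (∏ i, countMass r (ρ i) (n i)) • Measure.pi fun i => tilt r (n i) (ρ i) := by
    rw [← pi_withDensity ρ (fun i b => negBinMass r b (n i)) hnb,
      ← pi_smul _ fun i => countMass_ne_top hr _ _]
    simp_rw [withDensity_negBinMass hr]
  have h2 := lintegral_withDensity_eq_lintegral_mul (Measure.pi ρ) hD hG
  rw [h1, lintegral_smul_measure] at h2
  exact h2.symm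

lemma lintegral_crmLaw {ι : Type*} [Fintype ι] (m : Measure (I × X)) [IsFiniteMeasure m]
    (x : ι → X) (ρ : ι → Measure I) {G : Measure X → ℝ≥0∞} (hG : Measurable G) :
    ∫⁻ μ, G μ ∂(crmLaw m x ρ) = ∫⁻ b, ∫⁻ N,
      G (∑ i, weightedAtom (b i, x i) + weightedSum N) ∂(poissonProcessLaw m) ∂(Measure.pi ρ) := by
  have hGm : Measurable fun q : (ι → I) × Measure (I × X) =>
      G ((∑ i, ENNReal.ofReal (q.1 i : ℝ) • Measure.dirac (x i)) + weightedSum q.2) :=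
    hG.comp (measurable_crmMap x)
  rw [crmLaw, lintegral_map hG (measurable_crmMap x), lintegral_prod _ hGm.aemeasurable]
  rfl

/-- Bayes' rule for a completely random measure with labelled atoms: integrating first over the
labels, the conditional law of the random measure is that of a completely random measure with tilted
weights. -/
lemma lintegral_prod_labelLaw_mul {ι : Type*} [Fintype ι] {r : ℝ} (hr : 0 < r) (c : ι → Measure ℕ)
    (α : ι → Measure X) (ρ : ι → Measure I) [∀ i, SigmaFinite (c i)] [∀ i, SigmaFinite (α i)]
    [∀ i, IsFiniteMeasure (ρ i)] (m : Measure (I × X)) [IsFiniteMeasure m]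
    {F : Measure X × Measure X → ℝ≥0∞} (hF : Measurable F) :
    ∫⁻ p, F p ∂((∏ i, of ((labelLaw r (c i) (α i) (ρ i)).map labelPair)) *
        of ((poissonProcessLaw m).map fun N => ((0 : Measure X), weightedSum N))).val =
      ∫⁻ y, (∏ i, countMass r (ρ i) (y i).1) *
        ∫⁻ μ, F (∑ i, countAtom (y i), μ)
          ∂(crmLaw m (fun i => (y i).2) fun i => tilt r (y i).1 (ρ i))
        ∂(Measure.pi fun i => (c i).prod (α i)) := by
  have hW : Measurable fun N : Measure (I × X) => ((0 : Measure X), weightedSum N) := by fun_prop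
  have hS : Measurable fun p : (ι → ℕ × X) × (ι → I) =>
      (∑ i, countAtom (p.1 i), ∑ i, weightedAtom (p.2 i, (p.1 i).2)) :=
    (Finset.measurable_sum _ fun i _ => measurable_countAtom.comp
      (f := fun p : (ι → ℕ × X) × (ι → I) => p.1 i) (by fun_prop)).prodMk
    (Finset.measurable_sum _ fun i _ => measurable_weightedAtom.comp
      (f := fun p : (ι → ℕ × X) × (ι → I) => (p.2 i, (p.1 i).2)) (by fun_prop))
  have hSl : Measurable fun y : ι → (ℕ × X) × I => ∑ i, labelPair (y i) :=
    Finset.measurable_sum _ fun i _ => measurable_labelPair.comp (measurable_pi_apply i)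
  have hFW : Measurable fun q : (Measure X × Measure X) × Measure (I × X) =>
      F (q.1 + (0, weightedSum q.2)) :=
    hF.comp (measurable_fst.add (hW.comp measurable_snd))
  have hinner : Measurable fun p : Measure X × Measure X =>
      ∫⁻ N, F (p + (0, weightedSum N)) ∂(poissonProcessLaw m) := hFW.lintegral_prod_right'
  have hsum : ∀ y : ι → (ℕ × X) × I, ∑ i, labelPair (y i) =
      (∑ i, countAtom (y i).1, ∑ i, weightedAtom ((y i).2, (y i).1.2)) := fun y =>
    Prod.ext (by simp [Prod.fst_sum, labelPair]) (by simp [Prod.snd_sum, labelPair])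
  rw [lintegral_mul _ _ hF]
  simp only [val_of]
  have hpois : ∀ p : Measure X × Measure X, ∫⁻ q, F (p + q)
      ∂((poissonProcessLaw m).map fun N => ((0 : Measure X), weightedSum N)) =
      ∫⁻ N, F (p + (0, weightedSum N)) ∂(poissonProcessLaw m) := fun p =>
    lintegral_map (hF.comp (measurable_const.add measurable_id)) hW
  simp_rw [hpois]
  rw [prod_of_map _ _ fun _ => measurable_labelPair, lintegral_map hinner hSl]
  simp_rw [hsum]
  have hmain := lintegral_pi_labelLaw r c α ρ (hinner.comp hS)
  refine hmain.trans (lintegral_congr fun y => ?_)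
  refine (lintegral_prod_negBinMass hr (fun i => (y i).1) ρ
    ((hinner.comp hS).comp measurable_prodMk_left)).trans ?_
  congr 1
  refine Eq.trans ?_ (lintegral_crmLaw m _ _ (hF.comp measurable_prodMk_left)).symm
  simp only [Function.comp_def, Prod.mk_add_mk, add_zero]

end

/-! ### Splitting off the unobserved atoms -/

section
variable {X : Type*} [MeasurableSpace X]

lemma markedLaw_add (r : ℝ) (η : Measure (I × X)) (c d : Measure ℕ) [SFinite η] [SFinite c]
    [SFinite d] : markedLaw r η (c + d) = markedLaw r η c + markedLaw r η d := by
  rw [markedLaw, Measure.prod_add, withDensity_add_measure]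
  rfl

lemma negBinCoeff_zero {r : ℝ} (hr : 0 < r) : negBinCoeff r 0 = 1 := by
  simp [negBinCoeff, (Real.Gamma_pos_of_pos hr).ne']

/-- The unobserved points of a Poisson process are those whose count is `0`; they contribute nothing
to the counts, and their intensity carries the factor `(1 - b)^r`. -/
lemma map_markedLaw_dirac_zero {r : ℝ} (hr : 0 < r) (ν : Measure I) [IsFiniteMeasure ν]
    (α : Measure X) [SFinite α] :
    (markedLaw r (ν.prod α) (Measure.dirac 0)).map atomPair =
      ((reweight r 0 ν).prod α).map fun p => ((0 : Measure X), weightedAtom p) := by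
  refine Measure.ext_of_lintegral _ fun F hF => ?_
  have h1 : Measurable fun p : (I × X) × ℕ => negBinMass r p.1.1 p.2 :=
    (measurable_negBinMass r).comp (f := fun p : (I × X) × ℕ => (p.1.1, p.2)) (by fun_prop)
  have h2 : Measurable fun p : I × X => ((0 : Measure X), weightedAtom p) := by fun_prop
  have h3 := measurable_reweightDensity r 0
  have h4 : Measurable fun z : I × X => ENNReal.ofReal ((1 - (z.1 : ℝ)) ^ r * (z.1 : ℝ) ^ 0) :=
    h3.comp measurable_fst
  have hfin := isFiniteMeasure_reweight hr 0 ν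
  have hG : Measurable fun p : (I × X) × ℕ => negBinMass r p.1.1 p.2 * F (atomPair p) :=
    h1.mul (hF.comp measurable_atomPair)
  rw [lintegral_map hF measurable_atomPair, lintegral_map hF h2, markedLaw, reweight,
    prod_withDensity_left h3,
    lintegral_withDensity_eq_lintegral_mul _ h1 (g := fun p => F (atomPair p))
      (hF.comp measurable_atomPair),
    lintegral_withDensity_eq_lintegral_mul _ h4
      (g := fun p => F (0, weightedAtom p)) (hF.comp h2), Measure.prod_dirac,
    lintegral_map (by exact hG) (by fun_prop)]
  refine lintegral_congr fun p => ?_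
  simp only [Pi.mul_apply, negBinMass_eq hr, negBinCoeff_zero hr, one_mul,
    atomPair, countAtom, Nat.cast_zero, zero_smul]

lemma count_eq_dirac_add : (Measure.count : Measure ℕ) =
    Measure.dirac 0 + Measure.count.restrict {0}ᶜ := by
  conv_lhs => rw [← Measure.restrict_add_restrict_compl (μ := (Measure.count : Measure ℕ))
    (measurableSet_singleton 0)]
  rw [Measure.restrict_singleton, Measure.count_singleton, one_smul]

variable {κ : Type*} [Fintype κ]

/-- Base measures of the counts: any count for a fixed atom, a nonzero one for a new location. -/
noncomputable def countBase (κ : Type*) (k : ℕ) : κ ⊕ Fin k → Measure ℕ :=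
  Sum.elim (fun _ => Measure.count) fun _ => Measure.count.restrict {0}ᶜ

/-- Laws of the locations: fixed for a fixed atom, `α` for a new location. -/
noncomputable def locBase (loc : κ → X) (α : Measure X) (k : ℕ) : κ ⊕ Fin k → Measure X :=
  Sum.elim (fun l => Measure.dirac (loc l)) fun _ => α

/-- Prior measures of the weights at the observed atoms. -/
noncomputable def weightBase (h : κ → Measure I) (ν : Measure I) (k : ℕ) :
    κ ⊕ Fin k → Measure I :=
  Sum.elim h fun _ => ν

instance (k : ℕ) (i : κ ⊕ Fin k) : SigmaFinite (countBase κ k i) := by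
  rcases i with i | i <;> simp only [countBase, Sum.elim_inl, Sum.elim_inr] <;> infer_instance

instance (loc : κ → X) (α : Measure X) [SigmaFinite α] (k : ℕ) (i : κ ⊕ Fin k) :
    SigmaFinite (locBase loc α k i) := by
  rcases i with i | i <;> simp only [locBase, Sum.elim_inl, Sum.elim_inr] <;> infer_instance

instance (h : κ → Measure I) (ν : Measure I) [IsFiniteMeasure ν] [∀ k, IsFiniteMeasure (h k)]
    (k : ℕ) (i : κ ⊕ Fin k) : IsFiniteMeasure (weightBase h ν k i) := by
  rcases i with i | i <;> simp only [weightBase, Sum.elim_inl, Sum.elim_inr] <;> infer_instance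

/-- The joint law of counts and random measure, disintegrated along the number `k` of new locations
and the labels (count and location) of the atoms. -/
lemma lintegral_jointLaw {r : ℝ} (hr : 0 < r) (ν : Measure I) [IsFiniteMeasure ν]
    (α : Measure X) [IsFiniteMeasure α] (loc : κ → X) (h : κ → Measure I)
    [∀ k, IsFiniteMeasure (h k)] {F : Measure X × Measure X → ℝ≥0∞} (hF : Measurable F) :
    ∫⁻ p, F p ∂(poissonWeight (ν.prod α) •
      ((∏ k, of ((markedLaw r ((h k).prod (Measure.dirac (loc k))) Measure.count).map atomPair)) *
        exp (of ((markedLaw r (ν.prod α) Measure.count).map atomPair)))).val =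
    ∑' k : ℕ, (poissonWeight (ν.prod α) * (poissonWeight ((reweight r 0 ν).prod α))⁻¹ *
        (k.factorial : ℝ≥0∞)⁻¹) *
      ∫⁻ y, (∏ i, countMass r (weightBase h ν k i) (y i).1) *
        ∫⁻ μ, F (∑ i, countAtom (y i), μ)
          ∂(crmLaw ((reweight r 0 ν).prod α) (fun i => (y i).2)
            fun i => tilt r (y i).1 (weightBase h ν k i))
        ∂(Measure.pi fun i => (countBase κ k i).prod (locBase loc α k i)) := by
  have hfin := isFiniteMeasure_reweight hr 0 ν
  set m' := (reweight r 0 ν).prod α with hm'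
  have hW : Measurable fun N : Measure (I × X) => ((0 : Measure X), weightedSum N) := by fun_prop
  have hg : Measurable fun p : I × X => ((0 : Measure X), weightedAtom p) := by fun_prop
  have hw0 : poissonWeight m' ≠ 0 := by simp [poissonWeight, Real.exp_pos]
  have hwt : poissonWeight m' ≠ ∞ := ENNReal.ofReal_ne_top
  -- the exponential over the unobserved points is, up to a constant, a Poisson process again
  have hpois : of ((poissonProcessLaw m').map fun N => ((0 : Measure X), weightedSum N)) =
      poissonWeight m' • exp (of (m'.map fun p => ((0 : Measure X), weightedAtom p))) := by
    ext1
    exact map_poissonProcessLaw m' hW hg fun j y => by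
      rw [weightedSum_sum_dirac]
      exact Prod.ext (by simp [Prod.fst_sum]) (by simp [Prod.snd_sum])
  have hexp0 : exp (of (m'.map fun p => ((0 : Measure X), weightedAtom p))) =
      (poissonWeight m')⁻¹ •
        of ((poissonProcessLaw m').map fun N => ((0 : Measure X), weightedSum N)) := by
    rw [hpois, smul_smul, ENNReal.inv_mul_cancel hw0 hwt, one_smul]
  -- thinning: the Poisson points with count `0` and those with a nonzero count are independent
  have hsplit : of ((markedLaw r (ν.prod α) Measure.count).map atomPair) =
      of (m'.map fun p => ((0 : Measure X), weightedAtom p)) +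
        of ((labelLaw r (Measure.count.restrict {0}ᶜ) α ν).map labelPair) := by
    have h1 : markedLaw r (ν.prod α) Measure.count = markedLaw r (ν.prod α) (Measure.dirac 0) +
        markedLaw r (ν.prod α) (Measure.count.restrict {0}ᶜ) :=
      (congrArg _ count_eq_dirac_add).trans (markedLaw_add _ _ _ _)
    ext1
    rw [val_of, val_add, val_of, val_of, h1, Measure.map_add _ _ measurable_atomPair,
      map_markedLaw_dirac_zero hr, map_markedLaw_eq_map_labelLaw]
  have hfix : ∀ k, of ((markedLaw r ((h k).prod (Measure.dirac (loc k))) Measure.count).map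
      atomPair) = of ((labelLaw r Measure.count (Measure.dirac (loc k)) (h k)).map labelPair) :=
    fun k => by
      ext1
      exact map_markedLaw_eq_map_labelLaw _ _ _ _
  simp_rw [hfix]
  set A := ∏ k, of ((labelLaw r Measure.count (Measure.dirac (loc k)) (h k)).map labelPair) with hA
  set D := of ((labelLaw r (Measure.count.restrict {0}ᶜ) α ν).map labelPair) with hD
  set Po := of ((poissonProcessLaw m').map fun N => ((0 : Measure X), weightedSum N)) with hPo
  have hprod : ∀ k : ℕ, A * D ^ k = ∏ i : κ ⊕ Fin k, of ((labelLaw r (countBase κ k i)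
      (locBase loc α k i) (weightBase h ν k i)).map labelPair) := fun k => by
    have hpow : ∏ i : Fin k, of ((labelLaw r (countBase κ k (.inr i)) (locBase loc α k (.inr i))
        (weightBase h ν k (.inr i))).map labelPair) = D ^ k :=
      (Finset.prod_const (s := (Finset.univ : Finset (Fin k))) D).trans
        (by rw [Finset.card_univ, Fintype.card_fin])
    rw [Fintype.prod_sum_type, hpow]
    rfl
  have hval : (poissonWeight (ν.prod α) • (A * exp (of ((markedLaw r (ν.prod α)
      Measure.count).map atomPair)))).val = Measure.sum fun k : ℕ =>
        (poissonWeight (ν.prod α) * (poissonWeight m')⁻¹ * (k.factorial : ℝ≥0∞)⁻¹) •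
          ((∏ i : κ ⊕ Fin k, of ((labelLaw r (countBase κ k i)
            (locBase loc α k i) (weightBase h ν k i)).map labelPair)) * Po).val := by
    rw [hsplit, exp_add, hexp0]
    have h1 : poissonWeight (ν.prod α) • (A * ((poissonWeight m')⁻¹ • Po * exp D)) =
        (poissonWeight (ν.prod α) * (poissonWeight m')⁻¹) • ((A * Po) * exp D) := by
      rw [smul_mul_assoc, mul_smul_comm, smul_smul, mul_assoc]
    rw [h1, exp, val_smul, mul_val_sum, smul_measure_sum]
    congr 1
    funext k
    rw [mul_smul_comm, val_smul, smul_smul, ← hprod, mul_right_comm A]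
  rw [hval, lintegral_sum_measure]
  refine tsum_congr fun k => ?_
  rw [lintegral_smul_measure, lintegral_prod_labelLaw_mul hr _ _ _ m' hF, smul_eq_mul]

/-- The law of a completely random measure depends measurably on the labels of its fixed atoms. -/
lemma measurable_crmLaw_tilt {ι : Type*} [Fintype ι] {r : ℝ} (hr : 0 < r) (m : Measure (I × X))
    [IsFiniteMeasure m] (ρ : ι → Measure I) [∀ i, IsFiniteMeasure (ρ i)] :
    Measurable fun y : ι → ℕ × X => crmLaw m (fun i => (y i).2) fun i => tilt r (y i).1 (ρ i) := by
  -- the counts range over a countable set, so they may be fixed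
  have h1 : Measurable fun p : (ι → ℕ) × (ι → X) => crmLaw m p.2 fun i => tilt r (p.1 i) (ρ i) := by
    refine measurable_from_prod_countable_right fun n => ?_
    have hfin : ∀ i, IsFiniteMeasure (tilt r (n i) (ρ i)) := fun i => isFiniteMeasure_tilt hr _ _
    have hg : Measurable fun p : (ι → X) × ((ι → I) × Measure (I × X)) =>
        (∑ k, ENNReal.ofReal (p.2.1 k : ℝ) • Measure.dirac (p.1 k)) + weightedSum p.2.2 :=
      (Finset.measurable_sum _ fun i _ => measurable_smul_dirac (by fun_prop) (by fun_prop)).add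
        (measurable_weightedSum.comp (by fun_prop))
    refine Measure.measurable_of_measurable_coe _ fun s hs => ?_
    have h2 : ∀ x : ι → X, crmLaw m x (fun i => tilt r (n i) (ρ i)) s =
        ((Measure.pi fun i => tilt r (n i) (ρ i)).prod (poissonProcessLaw m))
          (Prod.mk x ⁻¹' ((fun p : (ι → X) × ((ι → I) × Measure (I × X)) =>
            (∑ k, ENNReal.ofReal (p.2.1 k : ℝ) • Measure.dirac (p.1 k)) +
              weightedSum p.2.2) ⁻¹' s)) :=
      fun x => by
        rw [crmLaw, Measure.map_apply (measurable_crmMap x) hs]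
        rfl
    simp only [h2]
    exact measurable_measure_prodMk_left (hg hs)
  exact h1.comp (f := fun y : ι → ℕ × X => (fun i => (y i).1, fun i => (y i).2)) (by fun_prop)

end

/-! ### Conditioning on a function of the labels -/

instance {ι : Type*} {E : ι → Type*} [Countable ι] [∀ i, MeasurableSpace (E i)]
    [∀ i, StandardBorelSpace (E i)] : StandardBorelSpace (Σ i, E i) := by
  let _ := fun i => upgradeStandardBorel (E i)
  have hB : BorelSpace (Σ i, E i) := by
    refine ⟨le_antisymm (fun s hs => ?_) (MeasurableSpace.generateFrom_le fun s hs => ?_)⟩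
    · have h1 : s = ⋃ i, Sigma.mk i '' (Sigma.mk i ⁻¹' s) := by
        ext ⟨i, x⟩
        simp only [Set.mem_iUnion, Set.mem_image, Set.mem_preimage]
        refine ⟨fun h => ⟨i, x, h, rfl⟩, fun ⟨_, _, h, h'⟩ => h' ▸ h⟩
      rw [h1]
      refine MeasurableSet.iUnion (m := borel _) fun i => ?_
      let _ : MeasurableSpace (Σ i, E i) := borel _
      have _ : BorelSpace (Σ i, E i) := ⟨rfl⟩
      exact Topology.IsOpenEmbedding.sigmaMk.measurableEmbedding.measurableSet_image.2
        (MeasurableSpace.measurableSet_iInf.1 hs i)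
    · exact MeasurableSpace.measurableSet_iInf.2 fun i => (isOpen_sigma_iff.1 hs i).measurableSet
  infer_instance

/-- Equality with a measurable family of finite measures is a measurable relation. -/
lemma measurableSet_eq_of_isFiniteMeasure {X Z : Type*} [MeasurableSpace X]
    [MeasurableSpace.CountablyGenerated X] [MeasurableSpace Z] {Φ : Z → Measure X}
    (hΦ : Measurable Φ) [∀ z, IsFiniteMeasure (Φ z)] :
    MeasurableSet {p : Measure X × Z | p.1 = Φ p.2} := by
  let S := generateSetAlgebra (MeasurableSpace.countableGeneratingSet X)
  have hS : S.Countable :=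
    countable_generateSetAlgebra (MeasurableSpace.countable_countableGeneratingSet)
  have hgen : MeasurableSpace.generateFrom S = ‹MeasurableSpace X› := by
    rw [generateFrom_generateSetAlgebra_eq, MeasurableSpace.generateFrom_countableGeneratingSet]
  have hSm : ∀ s ∈ S, MeasurableSet s := fun s hs => by
    rw [← hgen]
    exact MeasurableSpace.measurableSet_generateFrom hs
  have hpi : IsPiSystem S := fun s hs t ht _ => isSetAlgebra_generateSetAlgebra.inter_mem hs ht
  have heq : {p : Measure X × Z | p.1 = Φ p.2} = {p | p.1 Set.univ = Φ p.2 Set.univ} ∩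
      ⋂ s ∈ S, {p | p.1 s = Φ p.2 s} := by
    ext ⟨μ, z⟩
    simp only [Set.mem_ofPred_eq, Set.mem_inter_iff, Set.mem_iInter]
    constructor
    · rintro rfl
      simp
    · rintro ⟨hu, hs⟩
      exact (ext_of_generate_finite S hgen.symm hpi (fun s h => (hs s h).symm) hu.symm).symm
  have hm : ∀ s, MeasurableSet s → MeasurableSet {p : Measure X × Z | p.1 s = Φ p.2 s} :=
    fun s hs => measurableSet_eq_fun ((Measure.measurable_coe hs).comp measurable_fst)
      ((Measure.measurable_coe hs).comp (hΦ.comp measurable_snd))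
  rw [heq]
  exact (hm _ MeasurableSet.univ).inter (MeasurableSet.biInter hS fun s hs => hm s (hSm s hs))

/-- If the conditional law of a random element given a finer observation `x` only depends on the
coarser observation `Φ x`, then it is also the conditional law given `Φ x`. -/
lemma exists_kernel_of_compProd_map {Z A B : Type*} [MeasurableSpace Z] [MeasurableSpace A]
    [MeasurableSpace B] [StandardBorelSpace Z] [Nonempty Z] (τ : Measure Z) [IsFiniteMeasure τ]
    {Φ : Z → A} (hΦ : Measurable Φ) (hgraph : MeasurableSet {p : A × Z | p.1 = Φ p.2})
    (C : Kernel Z B) [IsMarkovKernel C] {good : Z → Prop} (hgood : ∀ᵐ z ∂τ, good z)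
    (hC : ∀ z z', good z → good z' → Φ z = Φ z' → C z = C z') :
    ∃ κ : Kernel A B, IsMarkovKernel κ ∧
      (τ ⊗ₘ C).map (fun p => (Φ p.1, p.2)) = (τ.map Φ) ⊗ₘ κ ∧
      ∀ᵐ a ∂(τ.map Φ), ∃ z, good z ∧ a = Φ z ∧ κ a = C z := by
  -- first draw `z` given `Φ z = a`, then draw from `C z`
  let D : Kernel A Z := condDistrib id Φ τ
  have hD : (τ.map Φ) ⊗ₘ D = τ.map fun z => (Φ z, z) :=
    compProd_map_condDistrib measurable_id.aemeasurable
  have hgm : Measurable fun z => (Φ z, z) := hΦ.prodMk measurable_id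
  refine ⟨C ∘ₖ D, inferInstance, ?_, ?_⟩
  · refine Measure.ext_of_lintegral _ fun F hF => ?_
    have h1 : Measurable fun p : Z × B => F (Φ p.1, p.2) := by fun_prop
    have h2 : Measurable fun q : A × Z => ∫⁻ b, F (q.1, b) ∂(C q.2) := by
      have := Measurable.lintegral_kernel_prod_right' (κ := C.comap (Prod.snd : A × Z → Z)
        measurable_snd) (f := fun q : (A × Z) × B => F (q.1.1, q.2)) (by fun_prop)
      exact this
    rw [lintegral_map hF (by fun_prop), Measure.lintegral_compProd h1,
      Measure.lintegral_compProd hF]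
    have h3 : ∀ a, ∫⁻ b, F (a, b) ∂((C ∘ₖ D) a) = ∫⁻ z, ∫⁻ b, F (a, b) ∂(C z) ∂(D a) := fun a =>
      Kernel.lintegral_comp _ _ _ (hF.comp measurable_prodMk_left)
    simp_rw [h3]
    rw [← Measure.lintegral_compProd (f := fun q : A × Z => ∫⁻ b, F (q.1, b) ∂(C q.2)) h2, hD,
      lintegral_map h2 hgm]
  -- `D a` is almost surely carried by the fibre of `Φ` over `a`, where `C` is constant
  · have h1 : ∀ᵐ p ∂((τ.map Φ) ⊗ₘ D), p.1 = Φ p.2 := by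
      rw [hD, ae_map_iff hgm.aemeasurable hgraph]
      simp
    have h2 : ∀ᵐ p ∂((τ.map Φ) ⊗ₘ D), good p.2 := by
      refine ae_of_ae_map (f := Prod.snd) measurable_snd.aemeasurable ?_
      rw [hD, Measure.map_map measurable_snd hgm]
      simpa [Function.comp_def] using hgood
    filter_upwards [Measure.ae_ae_of_ae_compProd (h1.and h2)] with a ha
    obtain ⟨z, haz, hz⟩ := ha.exists
    refine ⟨z, hz, haz, ?_⟩
    ext s hs
    rw [Kernel.comp_apply' _ _ _ hs]
    have h3 : ∀ᵐ z' ∂(D a), C z' s = C z s := by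
      filter_upwards [ha] with z' hz'
      rw [hC z' z hz'.2 hz (hz'.1.symm.trans haz)]
    rw [lintegral_congr_ae h3]
    simp

/-! ### Labels of the observed atoms and the posterior law -/

lemma measurableEmbedding_sigmaMk {ι : Type*} {E : ι → Type*} [∀ i, MeasurableSpace (E i)] (i : ι) :
    MeasurableEmbedding (Sigma.mk i : E i → Σ i, E i) where
  injective := sigma_mk_injective
  measurable := fun _ hs => MeasurableSpace.measurableSet_iInf.1 hs i
  measurableSet_image' := fun s hs => MeasurableSpace.measurableSet_iInf.2 fun j => by
    rcases eq_or_ne i j with rfl | hij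
    · change MeasurableSet (Sigma.mk i ⁻¹' (Sigma.mk i '' s))
      rwa [Set.preimage_image_eq _ sigma_mk_injective]
    · have h0 : Sigma.mk j ⁻¹' (Sigma.mk i '' s) = ∅ := by
        ext x
        simp only [Set.mem_preimage, Set.mem_image, Set.mem_empty_iff_false, iff_false]
        rintro ⟨a, -, h⟩
        exact hij (congrArg Sigma.fst h)
      change MeasurableSet (Sigma.mk j ⁻¹' (Sigma.mk i '' s))
      rw [h0]
      exact MeasurableSet.empty

lemma measurable_of_sigmaMk {ι β : Type*} {E : ι → Type*} [∀ i, MeasurableSpace (E i)]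
    [MeasurableSpace β] {f : (Σ i, E i) → β} (hf : ∀ i, Measurable fun x => f ⟨i, x⟩) :
    Measurable f :=
  fun _ hs => MeasurableSpace.measurableSet_iInf.2 fun i => hf i hs

section counting
variable {X : Type*} [MeasurableSpace X]

lemma countingMeasure_add (n n' : X →₀ ℕ) :
    countingMeasure (n + n') = countingMeasure n + countingMeasure n' :=
  Finsupp.sum_add_index' (h := fun x (k : ℕ) => (k : ℝ≥0∞) • Measure.dirac x) (by simp)
    (by simp [add_smul])

/-- The counts `n_x`, as a function of the location `x`, encoded by labels (count and location). -/
noncomputable def labelCounts {ι : Type*} [Fintype ι] (y : ι → ℕ × X) : X →₀ ℕ :=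
  ∑ i, Finsupp.single (y i).2 (y i).1

lemma countingMeasure_labelCounts {ι : Type*} [Fintype ι] (y : ι → ℕ × X) :
    countingMeasure (labelCounts y) = ∑ i, countAtom (y i) := by
  have h0 : countingMeasure (0 : X →₀ ℕ) = 0 := by simp [countingMeasure]
  have h1 : ∀ (x : X) (k : ℕ), countingMeasure (Finsupp.single x k) = countAtom (k, x) :=
    fun x k =>
      Finsupp.sum_single_index (h := fun x (k : ℕ) => (k : ℝ≥0∞) • Measure.dirac x) (by simp)
  let f : (X →₀ ℕ) →+ Measure X := ⟨⟨countingMeasure, h0⟩, countingMeasure_add⟩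
  refine (map_sum f _ _).trans (Finset.sum_congr rfl fun i _ => h1 _ _)

lemma countingMeasure_singleton [MeasurableSingletonClass X] (n : X →₀ ℕ) (x : X) :
    countingMeasure n {x} = n x := by
  classical
  simp only [countingMeasure, Measure.finsetSum_apply, Measure.smul_apply, smul_eq_mul,
    Measure.dirac_apply' _ (measurableSet_singleton x), Set.indicator_apply,
    Set.mem_singleton_iff, Pi.one_apply, mul_ite, mul_one, mul_zero, Finset.sum_ite_eq',
    Finsupp.mem_support_iff]
  split_ifs with h
  · rfl
  · simp [not_not.1 h]

lemma countingMeasure_injective [MeasurableSingletonClass X] :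
    Function.Injective (countingMeasure : (X →₀ ℕ) → Measure X) := fun n n' h => by
  ext x
  have := congrArg (fun μ : Measure X => μ {x}) h
  simpa only [countingMeasure_singleton, Nat.cast_inj] using this

lemma labelCounts_apply {X ι : Type*} [Fintype ι] {y : ι → ℕ × X}
    (hy : Function.Injective fun i => (y i).2) (i : ι) : labelCounts y (y i).2 = (y i).1 := by
  rw [labelCounts, Finsupp.finsetSum_apply, Finset.sum_eq_single i]
  · simp
  · intro j _ hj
    exact Finsupp.single_eq_of_ne fun h => hj (hy h.symm)
  · simp

lemma crmLaw_reindex {κ κ' : Type*} [Fintype κ] [Fintype κ'] (e : κ ≃ κ') (m : Measure (I × X))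
    [IsFiniteMeasure m] (loc : κ' → X) (h : κ' → Measure I) [∀ k, IsFiniteMeasure (h k)] :
    crmLaw m (fun k => loc (e k)) (fun k => h (e k)) = crmLaw m loc h := by
  rw [crmLaw_eq, crmLaw_eq, e.prod_comp fun k => of ((h k).map fun b => weightedAtom (b, loc k))]

end counting

section posterior
variable {L : ℕ}

/-- Labels of the observed atoms from which the counts and locations can be read off: the fixed
atoms come first, the locations are distinct, new locations have nonzero counts and every count
has positive probability. -/
structure AdmissibleLabels (r : ℝ) (ν : Measure I) (ψ : Fin L → I) (h : Fin L → Measure I) (k : ℕ)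
    (y : Fin L ⊕ Fin k → ℕ × I) : Prop where
  fixed : ∀ l, (y (.inl l)).2 = ψ l
  injective : Function.Injective fun i => (y i).2
  count_ne : ∀ j, (y (.inr j)).1 ≠ 0
  mass_ne : ∀ i, reweight r (y i).1 (weightBase h ν k i) Set.univ ≠ 0

lemma mem_newLocations {ψ : Fin L → I} {n : I →₀ ℕ} {x : I} :
    x ∈ newLocations ψ n ↔ n x ≠ 0 ∧ x ∉ Set.range ψ := by
  simp [newLocations]

/-- The conditional law given admissible labels only depends on the counting measure they encode,
and is the posterior law: the labels of the new locations just enumerate `newLocations`. -/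
lemma AdmissibleLabels.crmLaw_eq_posteriorLaw {r : ℝ} (hr : 0 < r) {ν : Measure I}
    [IsFiniteMeasure ν] {ψ : Fin L → I} {h : Fin L → Measure I} [∀ l, IsFiniteMeasure (h l)] {k : ℕ}
    {y : Fin L ⊕ Fin k → ℕ × I} (hy : AdmissibleLabels r ν ψ h k y) :
    crmLaw ((reweight r 0 ν).prod volume) (fun i => (y i).2)
        (fun i => tilt r (y i).1 (weightBase h ν k i)) =
      posteriorLaw r ν ψ h (labelCounts y) := by
  classical
  have hfin := isFiniteMeasure_reweight hr 0 ν
  have hn := labelCounts_apply hy.injective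
  have hmem : ∀ j : Fin k, (y (.inr j)).2 ∈ newLocations ψ (labelCounts y) := fun j => by
    refine mem_newLocations.2 ⟨?_, ?_⟩
    · rw [hn]
      exact hy.count_ne j
    · rintro ⟨l, hl⟩
      exact Sum.inl_ne_inr (hy.injective ((hy.fixed l).trans hl))
  have hsurj : ∀ x ∈ newLocations ψ (labelCounts y), ∃ j : Fin k, (y (.inr j)).2 = x := by
    intro x hx
    obtain ⟨hx1, hx2⟩ := mem_newLocations.1 hx
    by_contra! hne
    refine hx1 ?_
    rw [labelCounts, Finsupp.finsetSum_apply]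
    refine Finset.sum_eq_zero fun i _ => Finsupp.single_eq_of_ne fun hxi => ?_
    rcases i with l | j
    · exact hx2 ⟨l, (hy.fixed l).symm.trans hxi.symm⟩
    · exact hne j hxi.symm
  let e : Fin L ⊕ Fin k ≃ Fin L ⊕ {x // x ∈ newLocations ψ (labelCounts y)} :=
    Equiv.sumCongr (Equiv.refl _) (Equiv.ofBijective (fun j => ⟨(y (.inr j)).2, hmem j⟩)
      ⟨fun i j hij => Sum.inr_injective (hy.injective (congrArg Subtype.val hij)),
        fun x => (hsurj x x.2).imp fun j hj => Subtype.ext hj⟩)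
  have hfin' : ∀ i, IsFiniteMeasure (Sum.elim (fun l => tilt r (labelCounts y (ψ l)) (h l))
      (fun x : {x // x ∈ newLocations ψ (labelCounts y)} =>
        tilt r (labelCounts y (x : I)) ν) i) := by
    rintro (i | i)
    · exact isFiniteMeasure_tilt hr _ _
    · exact isFiniteMeasure_tilt hr _ _
  rw [posteriorLaw, ← crmLaw_reindex e]
  congr 1
  · funext i
    rcases i with l | j
    · exact hy.fixed l
    · rfl
  · funext i
    rcases i with l | j
    · change tilt r (y (.inl l)).1 (h l) = tilt r (labelCounts y (ψ l)) (h l)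
      rw [← hn, hy.fixed]
    · change tilt r (y (.inr j)).1 ν = tilt r (labelCounts y (y (.inr j)).2) ν
      rw [hn]

/-- Law of the labels of the observed atoms: the number `k` of new locations, and the counts and
locations of the fixed atoms and of the new locations. -/
noncomputable def labelsLaw (r : ℝ) (ν : Measure I) (ψ : Fin L → I) (h : Fin L → Measure I) :
    Measure (Σ k : ℕ, Fin L ⊕ Fin k → ℕ × I) :=
  Measure.sum fun k : ℕ =>
    (((poissonWeight (ν.prod (volume : Measure I)) *
        (poissonWeight ((reweight r 0 ν).prod (volume : Measure I)))⁻¹ * (k.factorial : ℝ≥0∞)⁻¹) •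
      (Measure.pi fun i => (countBase (Fin L) k i).prod (locBase ψ volume k i)).withDensity
        fun y => ∏ i, countMass r (weightBase h ν k i) (y i).1).map (Sigma.mk k))

lemma measurable_prod_countMass {ι : Type*} [Fintype ι] (r : ℝ) (ρ : ι → Measure I) :
    Measurable fun y : ι → ℕ × I => ∏ i, countMass r (ρ i) (y i).1 :=
  Finset.measurable_prod _ fun i _ => (Measurable.of_discrete (f := countMass r (ρ i))).comp
    (f := fun y : ι → ℕ × I => (y i).1) (by fun_prop)

instance (r : ℝ) (ν : Measure I) (ψ : Fin L → I) (h : Fin L → Measure I) :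
    SFinite (labelsLaw r ν ψ h) := by
  unfold labelsLaw
  infer_instance

lemma ae_admissibleLabels (r : ℝ) (ν : Measure I) {ψ : Fin L → I} (hψ : Function.Injective ψ)
    (h : Fin L → Measure I) : ∀ᵐ z ∂(labelsLaw r ν ψ h), AdmissibleLabels r ν ψ h z.1 z.2 := by
  rw [labelsLaw, Measure.ae_sum_iff]
  intro k
  rw [(measurableEmbedding_sigmaMk k).ae_map_iff]
  refine Measure.ae_smul_measure ?_ _
  rw [ae_withDensity_iff (measurable_prod_countMass r _)]
  have hfix : ∀ l : Fin L, ∀ᵐ y ∂(Measure.pi fun i : Fin L ⊕ Fin k =>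
      (countBase (Fin L) k i).prod (locBase ψ volume k i)), (y (.inl l)).2 = ψ l := fun l =>
    (Measure.tendsto_eval_ae_ae (μ := fun i : Fin L ⊕ Fin k =>
      (countBase (Fin L) k i).prod (locBase ψ volume k i)) (i := .inl l)).eventually
      (Measure.quasiMeasurePreserving_snd.ae (p := fun x => x = ψ l)
        (by
          change ∀ᵐ x ∂(Measure.dirac (ψ l)), x = ψ l
          simp [ae_dirac_eq]))
  have hne : ∀ j : Fin k, ∀ᵐ y ∂(Measure.pi fun i : Fin L ⊕ Fin k =>
      (countBase (Fin L) k i).prod (locBase ψ volume k i)), (y (.inr j)).1 ≠ 0 := fun j =>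
    (Measure.tendsto_eval_ae_ae (μ := fun i : Fin L ⊕ Fin k =>
      (countBase (Fin L) k i).prod (locBase ψ volume k i)) (i := .inr j)).eventually
      (Measure.quasiMeasurePreserving_fst.ae (p := fun x => x ≠ 0)
        (ae_restrict_mem (MeasurableSet.of_discrete (s := ({0}ᶜ : Set ℕ)))))
  have hloc : ∀ i : Fin L ⊕ Fin k, ∀ j : Fin k, i ≠ .inr j → ∀ᵐ y ∂(Measure.pi
      fun i : Fin L ⊕ Fin k => (countBase (Fin L) k i).prod (locBase ψ volume k i)),
      (y i).2 ≠ (y (.inr j)).2 := fun i j hij =>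
    ae_pi_ne _ measurable_snd hij fun z =>
      Measure.quasiMeasurePreserving_snd.preimage_null
        (measure_singleton (μ := (volume : Measure I)) z)
  filter_upwards [ae_all_iff.2 hfix, ae_all_iff.2 hne,
    ae_all_iff.2 fun i => ae_all_iff.2 fun j => ae_all_iff.2 (hloc i j)] with y h1 h2 h3 h4
  refine ⟨h1, ?_, h2, fun i hi => h4 (Finset.prod_eq_zero (Finset.mem_univ i) ?_)⟩
  · rintro (a | a) (b | b) hab
    · simp only [h1] at hab
      rw [hψ hab]
    · exact absurd hab (h3 _ _ (by simp))
    · exact absurd hab.symm (h3 _ _ (by simp))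
    · by_contra hne
      exact h3 _ _ hne hab
  · rw [countMass, hi, mul_zero]

open Classical in
/-- Conditional law of the completely random measure given the labels of the observed atoms
(an arbitrary value is used for the labels of probability zero). -/
noncomputable def labelsKernelFun (r : ℝ) (ν : Measure I) (h : Fin L → Measure I)
    (z : Σ k : ℕ, Fin L ⊕ Fin k → ℕ × I) : Measure (Measure I) :=
  if ∀ i, reweight r (z.2 i).1 (weightBase h ν z.1 i) Set.univ ≠ 0 then
    crmLaw ((reweight r 0 ν).prod volume) (fun i => (z.2 i).2)
      fun i => tilt r (z.2 i).1 (weightBase h ν z.1 i)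
  else Measure.dirac 0

lemma measurable_labelsKernelFun {r : ℝ} (hr : 0 < r) (ν : Measure I) [IsFiniteMeasure ν]
    (h : Fin L → Measure I) [∀ l, IsFiniteMeasure (h l)] :
    Measurable (labelsKernelFun r ν h) := by
  have hfin := isFiniteMeasure_reweight hr 0 ν
  refine measurable_of_sigmaMk fun k => Measurable.ite ?_
    (measurable_crmLaw_tilt hr ((reweight r 0 ν).prod (volume : Measure I)) (weightBase h ν k))
    measurable_const
  have h1 : Measurable fun (y : Fin L ⊕ Fin k → ℕ × I) i => (y i).1 := by fun_prop
  exact h1 (MeasurableSet.of_discrete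
    (s := {n : Fin L ⊕ Fin k → ℕ | ∀ i, reweight r (n i) (weightBase h ν k i) Set.univ ≠ 0}))

/-- `labelsKernelFun` as a kernel. -/
noncomputable def labelsKernel {r : ℝ} (hr : 0 < r) (ν : Measure I) [IsFiniteMeasure ν]
    (h : Fin L → Measure I) [∀ l, IsFiniteMeasure (h l)] :
    Kernel (Σ k : ℕ, Fin L ⊕ Fin k → ℕ × I) (Measure I) :=
  ⟨labelsKernelFun r ν h, measurable_labelsKernelFun hr ν h⟩

instance {r : ℝ} (hr : 0 < r) (ν : Measure I) [IsFiniteMeasure ν]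
    (h : Fin L → Measure I) [∀ l, IsFiniteMeasure (h l)] :
    IsMarkovKernel (labelsKernel hr ν h) := by
  refine ⟨fun z => ?_⟩
  change IsProbabilityMeasure (labelsKernelFun r ν h z)
  unfold labelsKernelFun
  have hfin := isFiniteMeasure_reweight hr 0 ν
  split_ifs with hz
  · have := fun i => isProbabilityMeasure_tilt hr (z.2 i).1 (weightBase h ν z.1 i) (hz i)
    infer_instance
  · infer_instance

lemma measurable_sum_countAtom :
    Measurable fun z : Σ k : ℕ, Fin L ⊕ Fin k → ℕ × I => ∑ i, countAtom (z.2 i) := by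
  refine measurable_of_sigmaMk fun k => ?_
  change Measurable fun y : Fin L ⊕ Fin k → ℕ × I => ∑ i, countAtom (y i)
  exact Finset.measurable_sum _ fun i _ => measurable_countAtom.comp (measurable_pi_apply i)

/-- The joint law of counts and random measure, disintegrated along the labels. -/
lemma jointLaw_eq_map_labelsLaw_compProd {r : ℝ} (hr : 0 < r) (ν : Measure I) [IsFiniteMeasure ν]
    (ψ : Fin L → I) (h : Fin L → Measure I) [∀ l, IsFiniteMeasure (h l)] :
    (poissonWeight (ν.prod (volume : Measure I)) •
      ((∏ l, of ((markedLaw r ((h l).prod (Measure.dirac (ψ l))) Measure.count).map atomPair)) *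
        exp (of ((markedLaw r (ν.prod (volume : Measure I)) Measure.count).map atomPair)))).val =
    (labelsLaw r ν ψ h ⊗ₘ labelsKernel hr ν h).map
      fun p => (∑ i, countAtom (p.1.2 i), p.2) := by
  have hΦ' : Measurable fun p : (Σ k : ℕ, Fin L ⊕ Fin k → ℕ × I) × Measure I =>
      (∑ i, countAtom (p.1.2 i), p.2) :=
    (measurable_sum_countAtom.comp measurable_fst).prodMk measurable_snd
  refine Measure.ext_of_lintegral _ fun F hF => ?_
  rw [lintegral_jointLaw hr ν volume ψ h hF, lintegral_map hF hΦ',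
    Measure.lintegral_compProd (f := fun p : (Σ k : ℕ, Fin L ⊕ Fin k → ℕ × I) × Measure I =>
      F (∑ i, countAtom (p.1.2 i), p.2)) (hF.comp hΦ'), labelsLaw, lintegral_sum_measure]
  refine tsum_congr fun k => ?_
  have hin : Measurable fun y : Fin L ⊕ Fin k → ℕ × I =>
      ∫⁻ μ, F (∑ i, countAtom (y i), μ) ∂(labelsKernel hr ν h ⟨k, y⟩) :=
    (Measurable.lintegral_kernel_prod_right' (κ := labelsKernel hr ν h) (hF.comp hΦ')).comp
      (measurableEmbedding_sigmaMk k).measurable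
  rw [(measurableEmbedding_sigmaMk k).lintegral_map, lintegral_smul_measure, smul_eq_mul,
    lintegral_withDensity_eq_lintegral_mul _ (measurable_prod_countMass r _) hin]
  congr 1
  refine lintegral_congr fun y => ?_
  simp only [Pi.mul_apply]
  by_cases hy : ∀ i, reweight r (y i).1 (weightBase h ν k i) Set.univ ≠ 0
  · have : labelsKernel hr ν h ⟨k, y⟩ = crmLaw ((reweight r 0 ν).prod volume) (fun i => (y i).2)
      fun i => tilt r (y i).1 (weightBase h ν k i) := if_pos hy
    rw [this]
  · push Not at hy
    obtain ⟨i, hi⟩ := hy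
    have h0 : ∏ i, countMass r (weightBase h ν k i) (y i).1 = 0 :=
      Finset.prod_eq_zero (Finset.mem_univ i) (by rw [countMass, hi, mul_zero])
    rw [h0, zero_mul, zero_mul]

end posterior

theorem mainTheorem2 {Ω : Type*} [MeasurableSpace Ω] (P : Measure Ω) [IsProbabilityMeasure P]
    (r : ℝ) (hr : 0 < r)
    (ν : Measure unitInterval) [IsFiniteMeasure ν] (hν : ∀ b, ν {b} = 0)
    (L : ℕ) (ψ : Fin L → unitInterval) (hψ : Function.Injective ψ)
    (h : Fin L → Measure unitInterval) [∀ l, IsProbabilityMeasure (h l)]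
    (hh : ∀ l, h l {1} = 0)
    (B J : Ω → Measure unitInterval) (hB : Measurable B) (hJ : Measurable J)
    (hprior : P.map B = crmLaw (ν.prod volume) ψ h)
    (hnbp : CondLawSatisfies P B J fun μ Q => IsNegBinProcess r μ Q) :
    CondLawSatisfies P J B fun ι Q =>
      ∃ n : unitInterval →₀ ℕ, ι = countingMeasure n ∧
        IsCompletelyRandom Q ∧ Q = posteriorLaw r ν ψ h n := by
  obtain ⟨K, hKm, hKeq, hK⟩ := hnbp
  rw [hprior] at hKeq hK
  have hfin := isFiniteMeasure_reweight hr 0 ν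
  let Φ : (Σ k : ℕ, Fin L ⊕ Fin k → ℕ × I) → Measure I := fun z => ∑ i, countAtom (z.2 i)
  have hΦ : Measurable Φ := measurable_sum_countAtom
  have hΦn : ∀ z, Φ z = countingMeasure (labelCounts z.2) := fun z =>
    (countingMeasure_labelCounts z.2).symm
  have hΦfin : ∀ z, IsFiniteMeasure (Φ z) := fun z => ⟨by
    simp [Φ, countAtom]⟩
  have hΦ' : Measurable fun p : (Σ k : ℕ, Fin L ⊕ Fin k → ℕ × I) × Measure I => (Φ p.1, p.2) :=
    (hΦ.comp measurable_fst).prodMk measurable_snd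
  have hjoint : P.map (fun ω => (J ω, B ω)) =
      (labelsLaw r ν ψ h ⊗ₘ labelsKernel hr ν h).map fun p => (Φ p.1, p.2) := by
    rw [← jointLaw_eq_map_labelsLaw_compProd hr ν ψ h, ← map_swap_crmLaw_compProd hr _ ?_ hψ h K hK,
      ← hKeq, Measure.map_map measurable_swap (hB.prodMk hJ)]
    · rfl
    · exact fun x => Measure.quasiMeasurePreserving_snd.preimage_null
        (measure_singleton (μ := (volume : Measure I)) x)
  -- the total mass of `labelsLaw` is that of the joint law of `(J, B)`
  have hτ : IsFiniteMeasure (labelsLaw r ν ψ h) := by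
    refine ⟨?_⟩
    have h1 : (labelsLaw r ν ψ h ⊗ₘ labelsKernel hr ν h) Set.univ = labelsLaw r ν ψ h Set.univ := by
      rw [Measure.compProd_apply MeasurableSet.univ]
      simp
    have h2 := congrArg (fun μ : Measure (Measure I × Measure I) => μ Set.univ) hjoint
    simp only [Measure.map_apply hΦ' MeasurableSet.univ, Set.preimage_univ, h1,
      Measure.map_apply (hJ.prodMk hB) MeasurableSet.univ, measure_univ] at h2
    rw [← h2]
    exact ENNReal.one_lt_top
  have hker : ∀ z : Σ k : ℕ, Fin L ⊕ Fin k → ℕ × I, AdmissibleLabels r ν ψ h z.1 z.2 →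
      labelsKernel hr ν h z = posteriorLaw r ν ψ h (labelCounts z.2) := fun z hz =>
    Eq.trans (if_pos hz.mass_ne) (hz.crmLaw_eq_posteriorLaw hr)
  have : Nonempty (Σ k : ℕ, Fin L ⊕ Fin k → ℕ × I) := ⟨⟨0, fun _ => (0, 0)⟩⟩
  obtain ⟨κ, hκm, hκ, hκae⟩ := exists_kernel_of_compProd_map (labelsLaw r ν ψ h) hΦ
    (measurableSet_eq_of_isFiniteMeasure hΦ) (labelsKernel hr ν h) (ae_admissibleLabels r ν hψ h)
    (fun z z' hz hz' hzz => by
      rw [hΦn, hΦn] at hzz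
      rw [hker z hz, hker z' hz', countingMeasure_injective hzz])
  have hfst : P.map J = (labelsLaw r ν ψ h).map Φ := by
    rw [← Measure.fst_compProd ((labelsLaw r ν ψ h).map Φ) κ, ← hκ, ← hjoint, Measure.fst,
      Measure.map_map measurable_fst (hJ.prodMk hB)]
    rfl
  refine ⟨κ, hκm, by rw [hjoint, hκ, hfst], ?_⟩
  rw [hfst]
  filter_upwards [hκae] with ι ⟨z, hz, hιz, hκz⟩
  refine ⟨labelCounts z.2, hιz.trans (hΦn z), ?_, hκz.trans (hker z hz)⟩
  have hprob := fun i =>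
    isProbabilityMeasure_tilt hr (z.2 i).1 (weightBase h ν z.1 i) (hz.mass_ne i)
  rw [hκz, hker z hz, ← hz.crmLaw_eq_posteriorLaw hr]
  exact isCompletelyRandom_crmLaw _ _ _
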